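/- All maps are $C^\infty$. Let $X$ be an open subset of $\mathbb{R}^n$ with coordinates $x$, and let $\mathcal{F}$ be a natural bundle of order $q$ over $X$ with fibre coordinates $u=(u^1,\dots,u^m)$ in an open set $U\subset\mathbb{R}^m$: changes of coordinates $\bar x=\varphi(x)$ lift (locally in $u$ and near the identity jet) to $\bar u=\lambda(u,j_q(\varphi)(x))$, where $\lambda$ is smooth, depends only on the derivatives of $\varphi$ of orders $1,\dots,q$, and is compatible with identity and composition. Let $L^\mu_k=L^{\tau\mu}_k(u)\,\partial/\partial u^\tau$ ($1\le|\mu|\le q$, $1\le k\le n$) be the corresponding infinitesimal generators on the fibre: $\lambda^\tau(u,j_q(\mathrm{id}+t\xi)(x))=u^\tau+t\,\partial_\mu\xi^k(x)L^{\tau\mu}_k(u)+O(t^2)$. Let $\omega$ be a section of $\mathcal{F}$ and $F_0=\omega^{-1}(V(\mathcal{F}))$, whose sections are written $\Omega=(\Omega^\tau(x))$. For $\xi_q=(\xi^k,\xi^k_\mu)\in J_q(T)$ put $$(L(\xi_q)\omega)^\tau=-L^{\tau\mu}_k(\omega(x))\,\xi^k_\mu+\xi^r\partial_r\omega^\tau(x),\qquad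 R_q=\{\xi_q\in J_q(T)\mid L(\xi_q)\omega=0\},$$ $$(L(\xi_q)\Omega)^\tau=-\frac{\partial L^{\tau\mu}_k}{\partial u^\sigma}(\omega(x))\,\Omega^\sigma(x)\,\xi^k_\mu+\xi^r\partial_r\Omega^\tau(x).$$ Assume that $R_q$ is transitive ($R_q\to T$ is onto) and that $\Phi:J_q(T)\to F_0$, $\xi_q\mapsto L(\xi_q)\omega$, is onto, so that $F_0=J_q(T)/R_q$. For open $Y\subset X$ let $\Upsilon_0(Y)$ be the space of $R_q$-invariant sections of $F_0$ over $Y$, i.e. of those $\Omega$ with $L(\xi_q)\Omega=0$ for all $\xi_q\in R_q$ over $Y$. For open $V\subset U$, the infinitesimal label transformations on $V$ are the vector fields $W=W^\tau(u)\,\partial/\partial u^\tau$ on $V$ with $[W,L^\mu_k]=0$ for all $\mu,k$; they form a real vector space, and a basis of it is called a system of infinitesimal generators of the label transformations on $V$. **Proposition 5.26.** Every $x_0\in X$ has the following property. There is a neighbourhood $V_0\subset U$ of $\omega(x_0)$ such that for every connected open $V\subset V_0$ and every connected open $Y\subset X$ with $x_0\in Y$ and $\omega(Y)\subset V$: a finite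 system of infinitesimal generators of the label transformations on $V$ exists, with at most $m=\dim F_0$ elements, and for every such system $W_1,\dots,W_p$, $$\Upsilon_0(Y)=\{\,\Omega^\tau(x)=A^\alpha W^\tau_\alpha(\omega(x))\mid A=\mathrm{cst}\in\mathbb{R}^p\,\},$$ where $A$ is uniquely determined by $\Omega$. **Corollary 5.27.** For the same $V,Y,W_\alpha$, put $\mathcal{D}\xi=L(j_q(\xi))\omega$, let $\Theta=\{\xi\in T\mid\mathcal{D}\xi=0\}$ (local solutions), and let $N(\Theta)=\{\eta\in T\mid[\xi,\eta]\in\Theta\ \text{for all local sections }\xi\text{ of }\Theta\}$. Consider, for a vector field $\eta$ on $Y$, the equation $$\mathcal{D}\eta=A^\alpha W_\alpha(\omega)\ \text{ on } Y\ \text{ for some constant } A. \tag{$*$}$$ (a) The solutions of $(*)$ are exactly the vector fields $\eta$ on $Y$ that satisfy the defining system of the normalizer, $L(j_{q+1}(\eta))\eta_q\in R_q$ for all local sections $\eta_q$ of $R_q$. Here $L(\xi_{q+1})\eta_q=\{\xi_{q+1},\eta_{q+1}\}+i(\xi)D\eta_{q+1}$ for any lift $\eta_{q+1}\in J_{q+1}(T)$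 of $\eta_q$; $\{\cdot,\cdot\}$ is the bilinear (algebraic) bracket determined by $\{j_{q+1}(\xi),j_{q+1}(\eta)\}=j_q([\xi,\eta])$, and $D$ is the Spencer operator, $(D\eta_{q+1})^k_{\mu,i}=\partial_i\eta^k_\mu-\eta^k_{\mu+1_i}$. (b) Every solution of $(*)$ belongs to $N(\Theta)$. If $R_q$ is the system of infinitesimal Lie equations of $\Theta$ on $Y$, i.e. every element of $R_q$ at a point of $Y$ is the $q$-jet of a local solution $\xi\in\Theta$, then conversely every $\eta\in N(\Theta)$ over $Y$ satisfies $(*)$, so $N(\Theta)$ is described by $L(j_q(\eta))\omega=AW(\omega)$ with $A$ constant. -/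

import Mathlib

open scoped ContDiff Topology
open Set

namespace LieEq

noncomputable section

section Jets

variable (E : Type*) [NormedAddCommGroup E] [NormedSpace ℝ E]

/-- Families of symmetric multilinear maps of degrees `1, …, q` on `E` with values in `E`;
the entry `i : Fin q` has degree `i + 1`. -/
def posJetSubmodule (q : ℕ) :
    Submodule ℝ (∀ i : Fin q, ContinuousMultilinearMap ℝ (fun _ : Fin (i + 1) => E) E) where
  carrier := {p | ∀ (i : Fin q) (σ : Equiv.Perm (Fin (i + 1))) (v : Fin (i + 1) → E),
    p i (v ∘ σ) = p i v}
  add_mem' := by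
    intro p r hp hr i σ v
    simp [hp i σ v, hr i σ v]
  zero_mem' := by
    intro i σ v
    simp
  smul_mem' := by
    intro c p hp i σ v
    simp [hp i σ v]

/-- The space of jet coordinates `(ξ^k_μ)`, `1 ≤ |μ| ≤ q`, of strictly positive order.
This is the fibre of `J_q^0(T)`, the kernel of `J_q(T) → T`. -/
def PosJet (q : ℕ) : Type _ := posJetSubmodule E q

instance (q : ℕ) : NormedAddCommGroup (PosJet E q) :=
  inferInstanceAs (NormedAddCommGroup (posJetSubmodule E q))

instance (q : ℕ) : NormedSpace ℝ (PosJet E q) :=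
  inferInstanceAs (NormedSpace ℝ (posJetSubmodule E q))

/-- The fibre of `J_q(T)`: the value `ξ^k` together with the coordinates `ξ^k_μ`,
`1 ≤ |μ| ≤ q`. -/
abbrev JetT (q : ℕ) : Type _ := E × PosJet E q

end Jets

variable {E : Type*} [NormedAddCommGroup E] [NormedSpace ℝ E]
variable {F : Type*} [NormedAddCommGroup F] [NormedSpace ℝ F]

/-- The derivatives of orders `1, …, q` of `f` at `x`. For a smooth `f` the symmetrization does
nothing, since the iterated derivatives are symmetric; it makes the value lie in `PosJet E q`
for every function `f`. -/
def posJet (q : ℕ) (f : E → E) (x : E) : PosJet E q :=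
  ⟨fun i => ((Nat.factorial (i + 1) : ℕ) : ℝ)⁻¹ • ∑ τ : Equiv.Perm (Fin (i + 1)),
      (iteratedFDeriv ℝ (i + 1) f x).domDomCongr τ, by
    intro i σ v
    simp only [_root_.smul_apply, _root_.sum_apply,
      ContinuousMultilinearMap.domDomCongr_apply]
    congr 1
    exact Fintype.sum_equiv (Equiv.mulLeft σ) _ _ fun τ => rfl⟩

/-- The `q`-jet `j_q(ξ)` at `x` of a vector field `ξ`. -/
def jet (q : ℕ) (ξ : E → E) (x : E) : JetT E q := (ξ x, posJet q ξ x)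

/-- The jet of positive order of the identity map. -/
def idJet (E : Type*) [NormedAddCommGroup E] [NormedSpace ℝ E] (q : ℕ) : PosJet E q :=
  posJet q (fun y : E => y) 0

/-- The polynomial vector field whose `q`-jet at `x` is `p`. -/
def taylorRep {q : ℕ} (x : E) (p : JetT E q) : E → E := fun y =>
  p.1 + ∑ i : Fin q, ((Nat.factorial (i + 1) : ℕ) : ℝ)⁻¹ • p.2.1 i (fun _ => y - x)

/-- A natural bundle of order `q` in local coordinates `(x, u)`, with `x` in the model space `E`
of the base and `u` in the open subset `carrier` of the model space `F` of the fibre.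
A change of coordinates `x̄ = φ(x)` is lifted to `x̄ = φ(x)`, `ū = lam (u, j_q(φ)(x))`, where `lam`
depends on the derivatives of `φ` of orders `1, …, q`. The lifting is compatible with the
identity and with composition. As always in charts, the action may be only local:
`ū` is defined for `(u, j_q(φ)(x))` in an open set `dom` that contains all `(u, j_q(id))`. -/
structure NaturalBundle (E F : Type*) [NormedAddCommGroup E] [NormedSpace ℝ E]
    [NormedAddCommGroup F] [NormedSpace ℝ F] (q : ℕ) where
  carrier : Set F
  isOpen_carrier : IsOpen carrier
  dom : Set (F × PosJet E q)
  isOpen_dom : IsOpen dom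
  lam : F × PosJet E q → F
  smooth : ContDiffOn ℝ ∞ lam dom
  /-- Jets in the domain are jets of local diffeomorphisms: the first derivative is invertible. -/
  invertible : ∀ z ∈ dom, ∀ h : 0 < q, Function.Bijective fun v : E => z.2.1 ⟨0, h⟩ fun _ => v
  fst_mem : ∀ z ∈ dom, z.1 ∈ carrier
  lam_mem : ∀ z ∈ dom, lam z ∈ carrier
  id_mem : ∀ u ∈ carrier, (u, idJet E q) ∈ dom
  lam_id : ∀ u ∈ carrier, lam (u, idJet E q) = u
  lam_comp : ∀ (φ ψ : E → E) (x : E) (u : F),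
    ContDiffAt ℝ ∞ φ x → ContDiffAt ℝ ∞ ψ (φ x) →
    (u, posJet q φ x) ∈ dom →
    (lam (u, posJet q φ x), posJet q ψ (φ x)) ∈ dom →
    (u, posJet q (ψ ∘ φ) x) ∈ dom →
    lam (lam (u, posJet q φ x), posJet q ψ (φ x)) = lam (u, posJet q (ψ ∘ φ) x)

variable {q : ℕ}

/-- `gen N u a = a^k_μ L^{τμ}_k(u)`: the value at `u` of the infinitesimal generator on the fibre
given by the jet direction `a`, that is, the derivative at the identity jet of
`lam (u, ·)` in the direction `a`. -/
def gen (N : NaturalBundle E F q) (u : F) : PosJet E q →L[ℝ] F :=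
  fderiv ℝ (fun p => N.lam (u, p)) (idJet E q)

/-- The Medolaghi map `ξ_q ↦ L(ξ_q)ω = -L^{τμ}_k(ω(x)) ξ^k_μ + ξ^r ∂_r ω^τ(x)` on the fibre
of `J_q(T)` at `x`. It is the map `Φ : J_q(T) → F_0 = ω⁻¹(V(𝓕))`. -/
def lieSection (N : NaturalBundle E F q) (ω₀ : E → F) (x : E) : JetT E q →ₗ[ℝ] F :=
  (fderiv ℝ ω₀ x : E →ₗ[ℝ] F) ∘ₗ LinearMap.fst ℝ E (PosJet E q)
    - (gen N (ω₀ x) : PosJet E q →ₗ[ℝ] F) ∘ₗ LinearMap.snd ℝ E (PosJet E q)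

/-- The fibre at `x` of the system `R_q` of infinitesimal Lie equations of `ω`. -/
def Rq (N : NaturalBundle E F q) (ω₀ : E → F) (x : E) : Submodule ℝ (JetT E q) :=
  LinearMap.ker (lieSection N ω₀ x)

/-- The formal Lie derivative on `F_0 = ω⁻¹(V(𝓕))`:
`L(ξ_q)Ω = ξ^r ∂_r Ω^τ - (∂L^{τμ}_k/∂u^σ)(ω(x)) Ω^σ ξ^k_μ`. A section of `F_0` is given by its
vertical component `Ω`. -/
def lieVertical (N : NaturalBundle E F q) (ω₀ Ω : E → F) (x : E) (p : JetT E q) : F :=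
  fderiv ℝ Ω x p.1 - fderiv ℝ (fun u => gen N u p.2) (ω₀ x) (Ω x)

/-- `Υ_0`: the `R_q`-invariant sections of `F_0` over `Y`. -/
def Upsilon0 (N : NaturalBundle E F q) (ω₀ : E → F) (Y : Set E) : Set (E → F) :=
  {Ω | ContDiffOn ℝ ∞ Ω Y ∧ ∀ x ∈ Y, ∀ p ∈ Rq N ω₀ x, lieVertical N ω₀ Ω x p = 0}

/-- Infinitesimal label transformations on the open subset `V` of the fibre: the vector fields
`W` with `[W, L^μ_k] = 0` for all `μ`, `k`. They are the infinitesimal transformations of the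
pseudogroup of all `ū = g(u)` that preserve every vector field `L^μ_k`. -/
def IsInfinitesimalLabel (N : NaturalBundle E F q) (V : Set F) (W : F → F) : Prop :=
  ContDiffOn ℝ ∞ W V ∧
    ∀ a : PosJet E q, ∀ u ∈ V, VectorField.lieBracket ℝ W (fun u' => gen N u' a) u = 0

/-- `W_1, …, W_p` are infinitesimal generators of the label transformations on `V`: a basis over
`ℝ` of the space of infinitesimal label transformations on `V`. -/
structure IsLabelBasis (N : NaturalBundle E F q) (V : Set F) {p : ℕ} (W : Fin p → F → F) :
    Prop where
  label : ∀ α, IsInfinitesimalLabel N V (W α)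
  independent : ∀ A : Fin p → ℝ, (∀ u ∈ V, ∑ α, A α • W α u = 0) → A = 0
  spanning : ∀ W' : F → F, IsInfinitesimalLabel N V W' →
    ∃ A : Fin p → ℝ, ∀ u ∈ V, W' u = ∑ α, A α • W α u

/-- The operator `𝒟ξ = ℒ(ξ)ω = L(j_q(ξ))ω`. -/
def lieOp (N : NaturalBundle E F q) (ω₀ : E → F) (ξ : E → E) (x : E) : F :=
  lieSection N ω₀ x (jet q ξ x)

/-- `Θ` over the open set `Y`: the vector fields on `Y` that are solutions of `R_q`. -/
def Theta (N : NaturalBundle E F q) (ω₀ : E → F) (Y : Set E) : Set (E → E) :=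
  {ξ | ContDiffOn ℝ ∞ ξ Y ∧ ∀ x ∈ Y, lieOp N ω₀ ξ x = 0}

/-- The normalizer `N(Θ)` over the open set `Y`: the vector fields `η` on `Y` with
`[ξ, η] ∈ Θ` for all local sections `ξ` of `Θ`. -/
def normalizer (N : NaturalBundle E F q) (ω₀ : E → F) (Y : Set E) : Set (E → E) :=
  {η | ContDiffOn ℝ ∞ η Y ∧ ∀ Z ⊆ Y, IsOpen Z → ∀ ξ ∈ Theta N ω₀ Z,
    VectorField.lieBracket ℝ ξ η ∈ Theta N ω₀ Z}

/-- The formal Lie derivative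
`L(j_{q+1}(ξ)) η_q = {j_{q+1}(ξ), η_{q+1}} + i(ξ) D η_{q+1}` of a section `η_q` of `J_q(T)`,
for any lift `η_{q+1}` of `η_q`. At the point `x` it is computed with the lift
`j_{q+1}(η̂)(x)`, where `η̂` is the Taylor polynomial of `η_q(x)`: then the algebraic bracket is
`j_q([ξ, η̂])(x)` and `D η_{q+1}` is the derivative of `η_q - j_q(η̂)` at `x`. -/
def lieJet (ξ : E → E) (η : E → JetT E q) (x : E) : JetT E q :=
  jet q (VectorField.lieBracket ℝ ξ (taylorRep x (η x))) x
    + fderiv ℝ (fun y => η y - jet q (taylorRep x (η x)) y) x (ξ x)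

/-- The solutions over `Y` of the system `R̃_{q+1}` that defines the normalizer formally: the
vector fields `ξ` on `Y` with `L(j_{q+1}(ξ)) η_q ∈ R_q` for all local sections `η_q` of `R_q`. -/
def formalNormalizer (N : NaturalBundle E F q) (ω₀ : E → F) (Y : Set E) : Set (E → E) :=
  {ξ | ContDiffOn ℝ ∞ ξ Y ∧ ∀ Z ⊆ Y, IsOpen Z → ∀ η : E → JetT E q, ContDiffOn ℝ ∞ η Z →
    (∀ x ∈ Z, η x ∈ Rq N ω₀ x) → ∀ x ∈ Z, lieJet ξ η x ∈ Rq N ω₀ x}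

/-- `R_q` is the system of infinitesimal Lie equations of `Θ`: every element of `R_q` is the
`q`-jet of a local section of `Θ`. -/
def IsSystemOfTheta (N : NaturalBundle E F q) (ω₀ : E → F) (X : Set E) : Prop :=
  ∀ x ∈ X, ∀ p ∈ Rq N ω₀ x, ∃ Z ⊆ X, IsOpen Z ∧ x ∈ Z ∧ ∃ ξ ∈ Theta N ω₀ Z, jet q ξ x = p

end

end LieEq

/-!
The derivative of `lam (u, ·)` at the identity jet gives the generators, `gen N u a`. Everything
rests on two consequences of the compatibility of the lifting with composition, obtained by
composing with `id + t ξ` and differentiating in `t`: an infinitesimal motion of the end point of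
the action is a composition of jets on the left (`fderiv_lam_comp_left`), and an infinitesimal
motion of its starting point is a composition on the right (`fderiv_lam_comp_right`).

*Label transformations.* At `u = ω(x₀)` the generators span the tangent space of the fibre, because
`R_q` is transitive and `Φ` is onto. Hence the orbit map `p ↦ lam (u, p)` has a local section `s`
with `s u = id` (`exists_section_orbit`). If the vector `w` at `u` is fixed by the isotropy of `u`,
put `W v = ∂_u lam (u, s v) w`. Differentiating the left composition rule shows that `[W, L_a] = 0`
would hold if `s` moved in the direction of the left translation by `a`; the actual direction
differs by a vector tangent to the fibre of the orbit map, which is a right translation by an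
isotropy direction, and along those `∂_u lam (u, ·) w` does not change by the right composition rule
(`fderiv_transport`). So every isotropy-fixed vector extends to a label transformation on a fixed
neighbourhood `V₀` (`exists_label_nhds`). No Frobenius theorem and no connectedness of isotropy
groups is needed. On `V₀` the equation `[W, L_a] = 0` expresses `dW` linearly through `W`, so by
Grönwall's inequality `W` is determined by one value on a connected set (`eq_zero_of_invariant`);
the label transformations on `V` thus correspond to the isotropy-fixed vectors at `u`.

*Invariant sections.* An `R_q`-invariant `Ω` satisfies the same kind of linear equation along `ω`,
and `Ω(x₀)` is fixed by the isotropy. The label transformation `W` with `W(ω(x₀)) = Ω(x₀)` gives an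
invariant section `W ∘ ω` with the same value at `x₀`, so the two agree (`mem_Upsilon0_iff`).

*The normalizer.* The mixed second derivative of the action along `η ∘ (id + t ξ)`, antisymmetrized,
shows that the generators form a Lie algebra (`gen_posJet_lieBracket`). It follows that
`𝒟[ξ, η] = L(ξ)(𝒟η) - L(η)(𝒟ξ)` and, for sections `σ` of `J_q(T)`,
`Φ(L(ξ)σ) = L(ξ)(Φσ) - L(σ)(𝒟ξ)` (`lieOp_lieBracket`, `lieSection_lieJet`). On solutions of `R_q`
one term vanishes, so both normalizer conditions on `η` say that `𝒟η` is an invariant section.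
-/

namespace LieEq

/-! ### Iterated derivatives -/

section IteratedDerivatives

variable {E F G : Type*} [NormedAddCommGroup E] [NormedSpace ℝ E]
  [NormedAddCommGroup F] [NormedSpace ℝ F] [NormedAddCommGroup G] [NormedSpace ℝ G]

/-- A directional derivative commutes with the iterated derivatives. -/
theorem iteratedFDeriv_fderiv_apply {n : ℕ} {f : E → F} {x : E} (v : E)
    (hf : ContDiffAt ℝ (n + 1 : ℕ) f x) :
    iteratedFDeriv ℝ n (fun y => fderiv ℝ f y v) x = fderiv ℝ (iteratedFDeriv ℝ n f) x v := by
  induction n generalizing x with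
  | zero =>
    have hd : DifferentiableAt ℝ f x := hf.differentiableAt (by simp)
    ext m
    have h0 := (continuousMultilinearCurryFin0 ℝ E F).symm.toContinuousLinearEquiv.hasFDerivAt.comp
      x hd.hasFDerivAt
    have h1 : fderiv ℝ (iteratedFDeriv ℝ 0 f) x = _ := h0.fderiv
    rw [h1]
    rfl
  | succ n ih =>
    have hev : ∀ᶠ y in 𝓝 x, ContDiffAt ℝ (n + 1 : ℕ) f y :=
      (hf.of_le (by norm_cast; omega)).eventually (by simp)
    have heq : iteratedFDeriv ℝ n (fun y => fderiv ℝ f y v) =ᶠ[𝓝 x]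
        fun y => fderiv ℝ (iteratedFDeriv ℝ n f) y v := hev.mono fun y hy => ih hy
    have h2 : ContDiffAt ℝ 2 (iteratedFDeriv ℝ n f) x :=
      hf.iteratedFDeriv_right (by norm_cast; omega)
    have h1 : DifferentiableAt ℝ (fderiv ℝ (iteratedFDeriv ℝ n f)) x :=
      (h2.fderiv_right (m := 1) (by norm_num)).differentiableAt (by simp)
    ext m
    rw [iteratedFDeriv_succ_apply_left, heq.fderiv_eq,
      fderiv_clm_apply h1 (differentiableAt_const v)]
    have hs := h2.isSymmSndFDerivAt (by simp) (m 0) v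
    have h3 : fderiv ℝ (iteratedFDeriv ℝ (n + 1) f) x v m
        = fderiv ℝ (fderiv ℝ (iteratedFDeriv ℝ n f)) x v (m 0) (Fin.tail m) := by
      have hd : DifferentiableAt ℝ (iteratedFDeriv ℝ (n + 1) f) x :=
        (hf.iteratedFDeriv_right (m := 1) (by norm_cast; omega)).differentiableAt (by simp)
      rw [← fderiv_continuousMultilinear_apply_const_apply hd]
      have h4 : HasFDerivAt (fun y => fderiv ℝ (iteratedFDeriv ℝ n f) y (m 0))
          ((fderiv ℝ (fderiv ℝ (iteratedFDeriv ℝ n f)) x).flip (m 0)) x := by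
        have := h1.hasFDerivAt.clm_apply (hasFDerivAt_const (m 0) x)
        simpa using this
      have h5 := h4.continuousMultilinear_apply_const (Fin.tail m)
      have h6 : fderiv ℝ (fun y => iteratedFDeriv ℝ (n + 1) f y m) x = _ := h5.fderiv
      rw [h6]
      rfl
    rw [h3, ← hs]
    simp

/-- The iterated derivatives of the composition with an affine map. -/
theorem iteratedFDeriv_comp_affine {n : ℕ} {f : E → F} (A : G →L[ℝ] E) (c : E) (y : G)
    (hf : ContDiffAt ℝ n f (c + A y)) :
    iteratedFDeriv ℝ n (fun z => f (c + A z)) y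
      = (iteratedFDeriv ℝ n f (c + A y)).compContinuousLinearMap fun _ => A := by
  have hf' : ContDiffAt ℝ n (fun w => f (c + w)) (A y) :=
    ContDiffAt.comp (A y) hf (by fun_prop)
  obtain ⟨u, hu, hfu⟩ := hf'.contDiffOn le_rfl (by simp)
  obtain ⟨s, hsu, hs, hys⟩ := mem_nhds_iff.1 hu
  have hfs := hfu.mono hsu
  have hAs : IsOpen (A ⁻¹' s) := hs.preimage A.continuous
  have h := A.iteratedFDerivWithin_comp_right hfs hs.uniqueDiffOn hAs.uniqueDiffOn hys
    (le_refl (n : WithTop ℕ∞))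
  rw [iteratedFDerivWithin_of_isOpen n hAs hys, iteratedFDerivWithin_of_isOpen n hs hys,
    iteratedFDeriv_comp_add_left] at h
  exact h

/-- Differentiation under the iterated derivative: the iterated derivative at `x` of a
one-parameter family of functions is differentiable in the parameter. -/
theorem hasDerivAt_iteratedFDeriv_family {n : ℕ} {f : ℝ × E → F} {x : E}
    (hf : ContDiffAt ℝ ∞ f (0, x)) :
    HasDerivAt (fun t : ℝ => iteratedFDeriv ℝ n (fun y => f (t, y)) x)
      (iteratedFDeriv ℝ n (fun y => fderiv ℝ f (0, y) (1, 0)) x) 0 := by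
  have hinr : ∀ (t : ℝ) (g : ℝ × E → F), (fun y => g (t, y))
      = fun y => g ((t, 0) + ContinuousLinearMap.inr ℝ ℝ E y) := by
    intro t g; ext y; simp
  have hpt : ∀ t : ℝ, ((t, 0) + ContinuousLinearMap.inr ℝ ℝ E x : ℝ × E) = (t, x) := by
    intro t; simp
  have hc : Filter.Tendsto (fun t : ℝ => ((t, x) : ℝ × E)) (𝓝 0) (𝓝 (0, x)) :=
    (Continuous.prodMk_left x).tendsto 0
  have hev : ∀ᶠ t : ℝ in 𝓝 0, ContDiffAt ℝ (n : ℕ) f (t, x) :=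
    hc.eventually ((hf.of_le (m := (n : ℕ)) (by exact_mod_cast le_top)).eventually (by simp))
  have heq : (fun t : ℝ => iteratedFDeriv ℝ n (fun y => f (t, y)) x) =ᶠ[𝓝 0]
      fun t => ContinuousMultilinearMap.compContinuousLinearMapL (F := F)
        (fun _ : Fin n => ContinuousLinearMap.inr ℝ ℝ E) (iteratedFDeriv ℝ n f (t, x)) := by
    filter_upwards [hev] with t ht
    rw [hinr t f, iteratedFDeriv_comp_affine _ _ _ (by rwa [hpt]), hpt]
    rfl
  have hn1 : ContDiffAt ℝ (n + 1 : ℕ) f (0, x) := hf.of_le (by exact_mod_cast le_top)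
  have hd : HasFDerivAt (iteratedFDeriv ℝ n f) (fderiv ℝ (iteratedFDeriv ℝ n f) (0, x)) (0, x) :=
    ((hn1.iteratedFDeriv_right (m := 1) (by norm_cast; omega)).differentiableAt
      (by simp)).hasFDerivAt
  have hcurve : HasDerivAt (fun t : ℝ => ((t, x) : ℝ × E)) (1, 0) 0 :=
    (hasDerivAt_id _).prodMk (hasDerivAt_const _ _)
  have h := (ContinuousLinearMap.hasFDerivAt
    (ContinuousMultilinearMap.compContinuousLinearMapL (F := F)
        (fun _ : Fin n => ContinuousLinearMap.inr ℝ ℝ E))).comp_hasDerivAt (0 : ℝ)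
    (hd.comp_hasDerivAt (0 : ℝ) hcurve)
  rw [hinr 0 (fun z => fderiv ℝ f z (1, 0)),
    iteratedFDeriv_comp_affine (f := fun z => fderiv ℝ f z (1, 0)), hpt,
    iteratedFDeriv_fderiv_apply _ hn1]
  · exact h.congr_of_eventuallyEq heq
  · rw [hpt]
    exact (hn1.fderiv_right (m := n) (by norm_cast)).clm_apply contDiffAt_const

end IteratedDerivatives

/-! ### Calculus of jets of positive order -/

section JetCalculus

variable {E : Type*} [NormedAddCommGroup E] [NormedSpace ℝ E] {q : ℕ}

theorem PosJet.ext {a b : PosJet E q} (h : ∀ i v, a.1 i v = b.1 i v) : a = b :=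
  Subtype.ext (funext fun i => ContinuousMultilinearMap.ext (h i))

theorem posJet_apply (f : E → E) (x : E) (i : Fin q) (v : Fin (i + 1) → E) :
    (posJet q f x).1 i v = ((Nat.factorial (i + 1) : ℕ) : ℝ)⁻¹ •
      ∑ τ : Equiv.Perm (Fin (i + 1)), iteratedFDeriv ℝ (i + 1) f x (v ∘ τ) := by
  simp only [posJet, smul_apply, sum_apply, ContinuousMultilinearMap.domDomCongr_apply]
  rfl

theorem posJet_congr {f g : E → E} {x : E} (h : f =ᶠ[𝓝 x] g) : posJet q f x = posJet q g x := by
  refine PosJet.ext fun i v => ?_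
  simp only [posJet_apply, (h.iteratedFDeriv ℝ (i + 1)).eq_of_nhds]

theorem posJet_add {f g : E → E} {x : E} (hf : ContDiffAt ℝ ∞ f x) (hg : ContDiffAt ℝ ∞ g x) :
    posJet q (fun y => f y + g y) x = posJet q f x + posJet q g x := by
  refine PosJet.ext fun i v => ?_
  have h : iteratedFDeriv ℝ (i + 1) (fun y => f y + g y) x
      = iteratedFDeriv ℝ (i + 1) f x + iteratedFDeriv ℝ (i + 1) g x :=
    fun_iteratedFDeriv_add_apply (hf.of_le (by exact_mod_cast le_top))
      (hg.of_le (by exact_mod_cast le_top))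
  change _ = (posJet q f x).1 i v + (posJet q g x).1 i v
  simp only [posJet_apply, h, add_apply, Finset.sum_add_distrib, smul_add]

theorem posJet_const_smul {f : E → E} {x : E} (c : ℝ) (hf : ContDiffAt ℝ ∞ f x) :
    posJet q (fun y => c • f y) x = c • posJet q f x := by
  refine PosJet.ext fun i v => ?_
  have h : iteratedFDeriv ℝ (i + 1) (fun y => c • f y) x = c • iteratedFDeriv ℝ (i + 1) f x :=
    iteratedFDeriv_const_smul_apply' (hf.of_le (by exact_mod_cast le_top))
  change _ = c • (posJet q f x).1 i v
  simp only [posJet_apply, h, smul_apply, ← Finset.smul_sum]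
  rw [smul_comm]

theorem posJet_sub {f g : E → E} {x : E} (hf : ContDiffAt ℝ ∞ f x) (hg : ContDiffAt ℝ ∞ g x) :
    posJet q (fun y => f y - g y) x = posJet q f x - posJet q g x := by
  have h := posJet_add (q := q) (g := fun y => (-1 : ℝ) • g y) hf (contDiffAt_const.smul hg)
  rw [posJet_const_smul _ hg] at h
  simpa [sub_eq_add_neg] using h

/-- The identity map has the same jet of positive order at every point. -/
theorem posJet_id (x : E) : posJet q (fun y : E => y) x = idJet E q := by
  refine PosJet.ext fun i v => ?_
  have h := iteratedFDeriv_comp_add_right (𝕜 := ℝ) (f := fun y : E => y) (i + 1) x (0 : E)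
  rw [zero_add] at h
  rw [idJet, posJet_apply, posJet_apply, ← h]
  congr 2
  ext τ
  have h2 : iteratedFDeriv ℝ (i + 1) (fun y : E => y + x) 0
      = iteratedFDeriv ℝ (i + 1) (fun y : E => y) 0 := by
    rw [iteratedFDeriv_succ_eq_comp_right, iteratedFDeriv_succ_eq_comp_right]
    simp
  rw [h2]

theorem posJet_id_add_smul {f : E → E} {x : E} (c : ℝ) (hf : ContDiffAt ℝ ∞ f x) :
    posJet q (fun y => y + c • f y) x = idJet E q + c • posJet q f x := by
  rw [posJet_add (f := fun y => y) (g := fun y => c • f y) contDiffAt_id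
    (contDiffAt_const.smul hf), posJet_const_smul _ hf, posJet_id]

theorem finiteDimensional_continuousMultilinearMap [FiniteDimensional ℝ E] (n : ℕ) :
    FiniteDimensional ℝ (ContinuousMultilinearMap ℝ (fun _ : Fin n => E) E) :=
  Module.Finite.of_injective
    (ContinuousMultilinearMap.toMultilinearMapLinear :
      ContinuousMultilinearMap ℝ (fun _ : Fin n => E) E →ₗ[ℝ] _)
    ContinuousMultilinearMap.toMultilinearMap_injective

instance [FiniteDimensional ℝ E] : FiniteDimensional ℝ (PosJet E q) := by
  have (i : Fin q) : FiniteDimensional ℝ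
      (ContinuousMultilinearMap ℝ (fun _ : Fin (i + 1) => E) E) :=
    finiteDimensional_continuousMultilinearMap _
  exact inferInstanceAs (FiniteDimensional ℝ (posJetSubmodule E q))

/-- Symmetrization of families of multilinear maps, as a linear map onto the jets of positive
order. -/
noncomputable def symmetrize (q : ℕ) :
    (∀ i : Fin q, ContinuousMultilinearMap ℝ (fun _ : Fin (i + 1) => E) E) →ₗ[ℝ] PosJet E q where
  toFun p := ⟨fun i => ((Nat.factorial (i + 1) : ℕ) : ℝ)⁻¹ •
      ∑ τ : Equiv.Perm (Fin (i + 1)), (p i).domDomCongr τ, by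
    intro i σ v
    simp only [smul_apply, sum_apply, ContinuousMultilinearMap.domDomCongr_apply]
    congr 1
    exact Fintype.sum_equiv (Equiv.mulLeft σ) _ _ fun τ => rfl⟩
  map_add' p r := by
    refine PosJet.ext fun i v => ?_
    change (((Nat.factorial (i + 1) : ℕ) : ℝ)⁻¹ •
        ∑ τ : Equiv.Perm (Fin (i + 1)), ((p + r) i).domDomCongr τ) v
      = (((Nat.factorial (i + 1) : ℕ) : ℝ)⁻¹ •
        ∑ τ : Equiv.Perm (Fin (i + 1)), (p i).domDomCongr τ) v
      + (((Nat.factorial (i + 1) : ℕ) : ℝ)⁻¹ •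
        ∑ τ : Equiv.Perm (Fin (i + 1)), (r i).domDomCongr τ) v
    simp only [smul_apply, sum_apply, ContinuousMultilinearMap.domDomCongr_apply, Pi.add_apply,
      add_apply, Finset.sum_add_distrib, smul_add]
  map_smul' c p := by
    refine PosJet.ext fun i v => ?_
    change (((Nat.factorial (i + 1) : ℕ) : ℝ)⁻¹ •
        ∑ τ : Equiv.Perm (Fin (i + 1)), ((c • p) i).domDomCongr τ) v
      = c • (((Nat.factorial (i + 1) : ℕ) : ℝ)⁻¹ •
        ∑ τ : Equiv.Perm (Fin (i + 1)), (p i).domDomCongr τ) v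
    simp only [smul_apply, sum_apply, ContinuousMultilinearMap.domDomCongr_apply, Pi.smul_apply,
      ← Finset.smul_sum]
    rw [smul_comm]

variable [FiniteDimensional ℝ E]

/-- The symmetrization, as a continuous linear map. -/
noncomputable def symmetrizeL (q : ℕ) :
    (∀ i : Fin q, ContinuousMultilinearMap ℝ (fun _ : Fin (i + 1) => E) E) →L[ℝ] PosJet E q :=
  have (i : Fin q) : FiniteDimensional ℝ
      (ContinuousMultilinearMap ℝ (fun _ : Fin (i + 1) => E) E) :=
    finiteDimensional_continuousMultilinearMap _
  LinearMap.toContinuousLinearMap (symmetrize q)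

theorem posJet_eq_symmetrizeL (f : E → E) (x : E) :
    posJet q f x = symmetrizeL q fun i => iteratedFDeriv ℝ (i + 1) f x := rfl

theorem contDiffAt_posJet {f : E → E} {x : E} (hf : ContDiffAt ℝ ∞ f x) :
    ContDiffAt ℝ ∞ (posJet q f) x := by
  have h : ContDiffAt ℝ ∞ (fun y => fun i : Fin q => iteratedFDeriv ℝ (i + 1) f y) x :=
    contDiffAt_pi.2 fun i => hf.iteratedFDeriv_right (i := i + 1) (by exact_mod_cast le_top)
  exact (symmetrizeL q).contDiff.contDiffAt.comp x h

theorem contDiffAt_jet {f : E → E} {x : E} (hf : ContDiffAt ℝ ∞ f x) :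
    ContDiffAt ℝ ∞ (jet q f) x :=
  hf.prodMk (contDiffAt_posJet hf)

/-- The jets of the maps `f ∘ (id + t g)` have, at `t = 0`, the jet of the derivative of `f`
along `g` as their derivative. -/
theorem hasDerivAt_posJet_comp {f g : E → E} {x : E} (hf : ContDiffAt ℝ ∞ f x)
    (hg : ContDiffAt ℝ ∞ g x) :
    HasDerivAt (fun t : ℝ => posJet q (fun y => f (y + t • g y)) x)
      (posJet q (fun y => fderiv ℝ f y (g y)) x) 0 := by
  set k : ℝ × E → E := fun z => f (z.2 + z.1 • g z.2) with hk
  have hks : ContDiffAt ℝ ∞ k (0, x) := by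
    have hg' : ContDiffAt ℝ ∞ (fun z : ℝ × E => g z.2) (0, x) :=
      ContDiffAt.comp (0, x) hg contDiffAt_snd
    refine ContDiffAt.comp (0, x) (g := f) ?_ (contDiffAt_snd.add (contDiffAt_fst.smul hg'))
    simpa using hf
  have h : HasDerivAt (fun t : ℝ => fun i : Fin q => iteratedFDeriv ℝ (i + 1) (fun y => k (t, y)) x)
      (fun i : Fin q => iteratedFDeriv ℝ (i + 1) (fun y => fderiv ℝ k (0, y) (1, 0)) x) 0 :=
    hasDerivAt_pi.2 fun i => hasDerivAt_iteratedFDeriv_family hks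
  have h2 : HasDerivAt (fun t : ℝ => posJet q (fun y => f (y + t • g y)) x)
      (posJet q (fun y => fderiv ℝ k (0, y) (1, 0)) x) 0 :=
    (symmetrizeL (E := E) q).hasFDerivAt.comp_hasDerivAt (0 : ℝ) h
  have h3 : (fun y => fderiv ℝ k (0, y) (1, 0)) =ᶠ[𝓝 x] fun y => fderiv ℝ f y (g y) := by
    filter_upwards [(hf.of_le (m := 1) (by exact_mod_cast le_top)).eventually (by simp),
      (hg.of_le (m := 1) (by exact_mod_cast le_top)).eventually (by simp)] with y hfy hgy
    have hc : HasDerivAt (fun t : ℝ => y + t • g y) (g y) 0 := by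
      simpa using ((hasDerivAt_id (0 : ℝ)).smul_const (g y)).const_add y
    have hfd : HasFDerivAt f (fderiv ℝ f y) (y + (0 : ℝ) • g y) := by
      simpa using (hfy.differentiableAt (by simp)).hasFDerivAt
    have h4 := hfd.comp_hasDerivAt (0 : ℝ) hc
    have hkd : DifferentiableAt ℝ k (0, y) := by
      have hg' : DifferentiableAt ℝ (fun z : ℝ × E => g z.2) (0, y) :=
        DifferentiableAt.comp (0, y) (hgy.differentiableAt (by simp)) differentiableAt_snd
      refine DifferentiableAt.comp (0, y) (g := f) hfd.differentiableAt
        (differentiableAt_snd.add (differentiableAt_fst.smul hg'))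
    have h5 := hkd.hasFDerivAt.comp_hasDerivAt (0 : ℝ)
      ((hasDerivAt_id (0 : ℝ)).prodMk (hasDerivAt_const (0 : ℝ) y))
    exact h5.unique h4
  rwa [posJet_congr h3] at h2

end JetCalculus

/-! ### Taylor polynomials -/

section Taylor

variable {E : Type*} [NormedAddCommGroup E] [NormedSpace ℝ E] {q : ℕ}

theorem contDiff_taylorRep (x : E) (p : JetT E q) : ContDiff ℝ ∞ (taylorRep x p) := by
  unfold taylorRep
  refine contDiff_const.add (ContDiff.sum fun i _ => contDiff_const.smul ?_)
  exact (p.2.1 i).contDiff.comp (contDiff_pi.2 fun _ => contDiff_id.sub contDiff_const)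

theorem taylorRep_self (x : E) (p : JetT E q) : taylorRep x p x = p.1 := by
  simp only [taylorRep, sub_self, add_eq_left]
  exact Finset.sum_eq_zero fun i _ => smul_eq_zero_of_right _ (p.2.1 i).map_zero

theorem taylorRep_add (x : E) (p r : JetT E q) (y : E) :
    taylorRep x (p + r) y = taylorRep x p y + taylorRep x r y := by
  have h (i : Fin q) : (p + r).2.1 i = p.2.1 i + r.2.1 i := rfl
  simp only [taylorRep, h, add_apply, smul_add, Finset.sum_add_distrib, Prod.fst_add]
  abel

theorem taylorRep_smul (x : E) (c : ℝ) (p : JetT E q) (y : E) :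
    taylorRep x (c • p) y = c • taylorRep x p y := by
  have h (i : Fin q) : (c • p).2.1 i = c • p.2.1 i := rfl
  simp only [taylorRep, h, smul_apply, smul_add, Finset.smul_sum, Prod.smul_fst]
  congr 1
  exact Finset.sum_congr rfl fun i _ => smul_comm _ _ _

/-- The finite power series at `x` of the Taylor polynomial of a jet. -/
noncomputable def taylorSeries (p : JetT E q) : FormalMultilinearSeries ℝ E E
  | 0 => ContinuousMultilinearMap.uncurry0 ℝ E p.1
  | n + 1 => if h : n < q then ((Nat.factorial (n + 1) : ℕ) : ℝ)⁻¹ • p.2.1 ⟨n, h⟩ else 0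

theorem hasFPowerSeriesOnBall_taylorRep (x : E) (p : JetT E q) :
    HasFPowerSeriesOnBall (taylorRep x p) (taylorSeries p) x ⊤ where
  r_le := by
    refine top_le_iff.2 (FormalMultilinearSeries.radius_eq_top_of_forall_image_add_eq_zero _
      (q + 1) fun m => ?_)
    change taylorSeries p (m + q + 1) = 0
    exact dif_neg (by omega)
  r_pos := by simp
  hasSum := by
    intro y _
    have h : ∑ n ∈ Finset.range (q + 1), taylorSeries p n (fun _ => y) = taylorRep x p (x + y) := by
      rw [Finset.sum_range_succ', add_comm, Finset.sum_range]
      simp only [taylorRep, add_sub_cancel_left]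
      congr 1
      refine Finset.sum_congr rfl fun i _ => ?_
      simp [taylorSeries]
    rw [← h]
    refine hasSum_sum_of_ne_finset_zero fun n hn => ?_
    obtain ⟨m, rfl⟩ : ∃ m, n = m + 1 :=
      ⟨n - 1, by have := Finset.mem_range.not.1 hn; omega⟩
    have : taylorSeries p (m + 1) = 0 :=
      dif_neg (by have := Finset.mem_range.not.1 hn; omega)
    rw [this]
    rfl

/-- The Taylor polynomial of a jet has this jet. -/
theorem posJet_taylorRep [FiniteDimensional ℝ E] (x : E) (p : JetT E q) :
    posJet q (taylorRep x p) x = p.2 := by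
  have : CompleteSpace E := FiniteDimensional.complete ℝ E
  have key (i : Fin q) (v : Fin (i + 1) → E) :
      iteratedFDeriv ℝ (i + 1) (taylorRep x p) x v = p.2.1 i v := by
    rw [(hasFPowerSeriesOnBall_taylorRep x p).iteratedFDeriv_eq_sum_of_completeSpace]
    have h (σ : Equiv.Perm (Fin (i + 1))) : taylorSeries p (i + 1) (fun j => v (σ j))
        = ((Nat.factorial (i + 1) : ℕ) : ℝ)⁻¹ • p.2.1 i v := by
      have h1 : taylorSeries p (i + 1)
          = ((Nat.factorial (i + 1) : ℕ) : ℝ)⁻¹ • p.2.1 i := dif_pos i.2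
      rw [h1, smul_apply]
      congr 1
      exact p.2.2 i σ v
    simp only [h, Finset.sum_const, Finset.card_univ, Fintype.card_perm, Fintype.card_fin]
    rw [← Nat.cast_smul_eq_nsmul ℝ, smul_smul, mul_inv_cancel₀, one_smul]
    exact_mod_cast Nat.factorial_ne_zero _
  refine PosJet.ext fun i v => ?_
  have h (σ : Equiv.Perm (Fin (i + 1))) : p.2.1 i (v ∘ σ) = p.2.1 i v := p.2.2 i σ v
  rw [posJet_apply]
  simp only [key, h, Finset.sum_const, Finset.card_univ, Fintype.card_perm, Fintype.card_fin]
  rw [← Nat.cast_smul_eq_nsmul ℝ, smul_smul, inv_mul_cancel₀, one_smul]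
  exact_mod_cast Nat.factorial_ne_zero _

theorem jet_taylorRep [FiniteDimensional ℝ E] (x : E) (p : JetT E q) :
    jet q (taylorRep x p) x = p :=
  Prod.ext (taylorRep_self x p) (posJet_taylorRep x p)

/-- The polynomial map without constant term that has a given jet of positive order at `0`. -/
noncomputable def polyMap (a : PosJet E q) : E → E := taylorRep 0 (0, a)

theorem contDiff_polyMap (a : PosJet E q) : ContDiff ℝ ∞ (polyMap a) := contDiff_taylorRep _ _

theorem polyMap_zero (a : PosJet E q) : polyMap a 0 = 0 := taylorRep_self _ _

theorem polyMap_add (a b : PosJet E q) (y : E) : polyMap (a + b) y = polyMap a y + polyMap b y := by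
  rw [polyMap, polyMap, polyMap, ← taylorRep_add]
  simp

theorem polyMap_smul (c : ℝ) (a : PosJet E q) (y : E) : polyMap (c • a) y = c • polyMap a y := by
  rw [polyMap, polyMap, ← taylorRep_smul]
  simp

theorem posJet_polyMap [FiniteDimensional ℝ E] (a : PosJet E q) : posJet q (polyMap a) 0 = a :=
  posJet_taylorRep _ _

end Taylor

/-! ### The infinitesimal action on the fibre -/

section Action

variable {E F : Type*} [NormedAddCommGroup E] [NormedSpace ℝ E]
  [NormedAddCommGroup F] [NormedSpace ℝ F] {q : ℕ}

theorem contDiffAt_lam (N : NaturalBundle E F q) {z : F × PosJet E q} (hz : z ∈ N.dom) :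
    ContDiffAt ℝ ∞ N.lam z :=
  N.smooth.contDiffAt (N.isOpen_dom.mem_nhds hz)

theorem hasFDerivAt_lam (N : NaturalBundle E F q) {z : F × PosJet E q} (hz : z ∈ N.dom) :
    HasFDerivAt N.lam (fderiv ℝ N.lam z) z :=
  ((contDiffAt_lam N hz).differentiableAt (by simp)).hasFDerivAt

theorem contDiffAt_fderiv_lam (N : NaturalBundle E F q) {z : F × PosJet E q} (hz : z ∈ N.dom) :
    ContDiffAt ℝ ∞ (fderiv ℝ N.lam) z :=
  (contDiffAt_lam N hz).fderiv_right (by simp)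

theorem hasFDerivAt_fderiv_lam (N : NaturalBundle E F q) {z : F × PosJet E q} (hz : z ∈ N.dom) :
    HasFDerivAt (fderiv ℝ N.lam) (fderiv ℝ (fderiv ℝ N.lam) z) z :=
  ((contDiffAt_fderiv_lam N hz).differentiableAt (by simp)).hasFDerivAt

theorem fderiv_fderiv_lam_symm (N : NaturalBundle E F q) {z : F × PosJet E q} (hz : z ∈ N.dom)
    (v w : F × PosJet E q) :
    fderiv ℝ (fderiv ℝ N.lam) z v w = fderiv ℝ (fderiv ℝ N.lam) z w v :=
  (contDiffAt_lam N hz).isSymmSndFDerivAt (by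
    rw [minSmoothness_of_isRCLikeNormedField]
    exact WithTop.coe_le_coe.2 (le_top : (2 : ℕ∞) ≤ ⊤)) v w

theorem gen_eq (N : NaturalBundle E F q) {u : F} (hu : u ∈ N.carrier) :
    gen N u = (fderiv ℝ N.lam (u, idJet E q)).comp (ContinuousLinearMap.inr ℝ F (PosJet E q)) :=
  ((hasFDerivAt_lam N (N.id_mem u hu)).comp (idJet E q)
    (hasFDerivAt_prodMk_right u (idJet E q))).fderiv

theorem gen_apply (N : NaturalBundle E F q) {u : F} (hu : u ∈ N.carrier) (a : PosJet E q) :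
    gen N u a = fderiv ℝ N.lam (u, idJet E q) (0, a) := by
  rw [gen_eq N hu]
  rfl

theorem contDiffAt_gen (N : NaturalBundle E F q) {u : F} (hu : u ∈ N.carrier) :
    ContDiffAt ℝ ∞ (gen N) u := by
  have h1 : ContDiffAt ℝ ∞ (fun u : F => fderiv ℝ N.lam (u, idJet E q)) u :=
    ContDiffAt.comp u (contDiffAt_fderiv_lam N (N.id_mem u hu))
      (contDiffAt_id.prodMk contDiffAt_const)
  have h2 : ContDiffAt ℝ ∞ (fun u : F => (fderiv ℝ N.lam (u, idJet E q)).comp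
      (ContinuousLinearMap.inr ℝ F (PosJet E q))) u := h1.clm_comp contDiffAt_const
  refine h2.congr_of_eventuallyEq ?_
  filter_upwards [N.isOpen_carrier.mem_nhds hu] with v hv using gen_eq N hv

theorem hasFDerivAt_gen (N : NaturalBundle E F q) {u : F} (hu : u ∈ N.carrier) :
    HasFDerivAt (gen N) (fderiv ℝ (gen N) u) u :=
  ((contDiffAt_gen N hu).differentiableAt (by simp)).hasFDerivAt

theorem fderiv_gen_apply (N : NaturalBundle E F q) {u : F} (hu : u ∈ N.carrier) (a : PosJet E q)
    (w : F) : fderiv ℝ (fun u => gen N u a) u w = fderiv ℝ (gen N) u w a := by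
  have h := (hasFDerivAt_gen N hu).clm_apply (hasFDerivAt_const a u)
  rw [h.fderiv]
  simp

/-- The derivative of the action along the identity fibre of the jets fixes the fibre
coordinate. -/
theorem fderiv_lam_id_fst (N : NaturalBundle E F q) {u : F} (hu : u ∈ N.carrier) (w : F) :
    fderiv ℝ N.lam (u, idJet E q) (w, 0) = w := by
  have h1 : HasFDerivAt (fun v : F => N.lam (v, idJet E q)) _ u :=
    (hasFDerivAt_lam N (N.id_mem u hu)).comp u (hasFDerivAt_prodMk_left u (idJet E q))
  have h2 : HasFDerivAt (fun v : F => N.lam (v, idJet E q)) (ContinuousLinearMap.id ℝ F) u :=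
    (hasFDerivAt_id u).congr_of_eventuallyEq <| by
      filter_upwards [N.isOpen_carrier.mem_nhds hu] with v hv using N.lam_id v hv
  exact congrArg (fun A : F →L[ℝ] F => A w) (h1.unique h2)

theorem hasDerivAt_lam_add_smul (N : NaturalBundle E F q) {u : F} {p : PosJet E q}
    (hz : (u, p) ∈ N.dom) (a : PosJet E q) :
    HasDerivAt (fun t : ℝ => N.lam (u, p + t • a)) (fderiv ℝ N.lam (u, p) (0, a)) 0 := by
  have hc : HasDerivAt (fun t : ℝ => (u, p + t • a)) ((0 : F), a) 0 := by
    have h := ((hasDerivAt_id (0 : ℝ)).smul_const a).const_add p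
    simpa using (hasDerivAt_const (0 : ℝ) u).prodMk h
  have hl : HasFDerivAt N.lam (fderiv ℝ N.lam (u, p)) (u, p + (0 : ℝ) • a) := by
    simpa using hasFDerivAt_lam N hz
  exact hl.comp_hasDerivAt (0 : ℝ) hc

theorem eventually_add_smul_mem_dom (N : NaturalBundle E F q) {u : F} {p : PosJet E q}
    (hz : (u, p) ∈ N.dom) (a : PosJet E q) : ∀ᶠ t : ℝ in 𝓝 0, (u, p + t • a) ∈ N.dom := by
  have hc : Continuous fun t : ℝ => (u, p + t • a) := by fun_prop
  refine hc.continuousAt.eventually_mem (N.isOpen_dom.mem_nhds ?_)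
  simpa using hz

/-- Moving the end point of the action infinitesimally by the jet of `η` amounts to composing the
jet of `φ` with `η`. -/
theorem fderiv_lam_comp_left (N : NaturalBundle E F q) {u : F} {φ η : E → E} {x : E}
    (hφ : ContDiffAt ℝ ∞ φ x) (hη : ContDiffAt ℝ ∞ η (φ x)) (hz : (u, posJet q φ x) ∈ N.dom) :
    gen N (N.lam (u, posJet q φ x)) (posJet q η (φ x))
      = fderiv ℝ N.lam (u, posJet q φ x) (0, posJet q (fun y => η (φ y)) x) := by
  have hv := N.lam_mem _ hz
  have hid := N.id_mem _ hv
  have hηφ : ContDiffAt ℝ ∞ (fun y => η (φ y)) x := hη.comp x hφ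
  rw [gen_apply N hv]
  refine (hasDerivAt_lam_add_smul N hid (posJet q η (φ x))).unique
    ((hasDerivAt_lam_add_smul N hz (posJet q (fun y => η (φ y)) x)).congr_of_eventuallyEq ?_)
  filter_upwards [eventually_add_smul_mem_dom N hid (posJet q η (φ x)),
    eventually_add_smul_mem_dom N hz (posJet q (fun y => η (φ y)) x)] with s h1 h2
  have e1 : posJet q (fun y => y + s • η y) (φ x) = idJet E q + s • posJet q η (φ x) :=
    posJet_id_add_smul s hη
  have e2 : posJet q ((fun y => y + s • η y) ∘ φ) x
      = posJet q φ x + s • posJet q (fun y => η (φ y)) x := by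
    rw [← posJet_const_smul s hηφ, ← posJet_add (g := fun y => s • η (φ y)) hφ (contDiffAt_const.smul hηφ)]
    rfl
  have h := N.lam_comp φ (fun y => y + s • η y) x u hφ
    (contDiffAt_id.add (contDiffAt_const.smul hη)) hz (by rwa [e1]) (by rwa [e2])
  rwa [e1, e2] at h

variable [FiniteDimensional ℝ E]

/-- The second mixed derivative of the action along `η ∘ (id + t ξ)`. It is symmetric in the
jets of `ξ` and `η` up to terms that involve the generators only. -/
theorem fderiv_gen_gen (N : NaturalBundle E F q) {u : F} (hu : u ∈ N.carrier) {ξ η : E → E} {x : E}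
    (hξ : ContDiffAt ℝ ∞ ξ x) (hη : ∀ᶠ y in 𝓝 x, ContDiffAt ℝ ∞ η y) :
    fderiv ℝ (gen N) u (gen N u (posJet q ξ x)) (posJet q η x)
        + gen N u (fderiv ℝ (posJet q η) x (ξ x))
      = fderiv ℝ (fderiv ℝ N.lam) (u, idJet E q) (0, posJet q ξ x) (0, posJet q η x)
        + gen N u (posJet q (fun y => fderiv ℝ η y (ξ y)) x) := by
  have hid := N.id_mem u hu
  have hηx : ContDiffAt ℝ ∞ η x := hη.self_of_nhds
  set a := posJet q ξ x with ha
  have hlam0 : N.lam (u, idJet E q + (0 : ℝ) • a) = u := by simpa using N.lam_id u hu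
  have hx0 : x + (0 : ℝ) • ξ x = x := by simp
  have hline : HasDerivAt (fun t : ℝ => x + t • ξ x) (ξ x) 0 := by
    simpa using ((hasDerivAt_id (0 : ℝ)).smul_const (ξ x)).const_add x
  -- the derivative of the left side of `fderiv_lam_comp_left` for `φ = id + t ξ`
  have hl1 : HasDerivAt (fun t : ℝ => gen N (N.lam (u, idJet E q + t • a)))
      (fderiv ℝ (gen N) u (gen N u a)) 0 := by
    have h := hasDerivAt_lam_add_smul N hid a
    rw [← gen_apply N hu] at h
    have hg : HasFDerivAt (gen N) (fderiv ℝ (gen N) u) (N.lam (u, idJet E q + (0 : ℝ) • a)) := by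
      rw [hlam0]; exact hasFDerivAt_gen N hu
    exact hg.comp_hasDerivAt (0 : ℝ) h
  have hl2 : HasDerivAt (fun t : ℝ => posJet q η (x + t • ξ x))
      (fderiv ℝ (posJet q η) x (ξ x)) 0 := by
    have hg : HasFDerivAt (posJet q η) (fderiv ℝ (posJet q η) x) (x + (0 : ℝ) • ξ x) := by
      rw [hx0]; exact ((contDiffAt_posJet hηx).differentiableAt (by simp)).hasFDerivAt
    exact hg.comp_hasDerivAt (0 : ℝ) hline
  have hl := hl1.clm_apply hl2
  -- the derivative of the right side
  have hr1 : HasDerivAt (fun t : ℝ => fderiv ℝ N.lam (u, idJet E q + t • a))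
      (fderiv ℝ (fderiv ℝ N.lam) (u, idJet E q) (0, a)) 0 := by
    have hc : HasDerivAt (fun t : ℝ => (u, idJet E q + t • a)) ((0 : F), a) 0 := by
      have h := ((hasDerivAt_id (0 : ℝ)).smul_const a).const_add (idJet E q)
      simpa using (hasDerivAt_const (0 : ℝ) u).prodMk h
    have hg : HasFDerivAt (fderiv ℝ N.lam) (fderiv ℝ (fderiv ℝ N.lam) (u, idJet E q))
        (u, idJet E q + (0 : ℝ) • a) := by
      simpa using hasFDerivAt_fderiv_lam N hid
    exact hg.comp_hasDerivAt (0 : ℝ) hc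
  have hr2 := (hasDerivAt_const (0 : ℝ) (0 : F)).prodMk (hasDerivAt_posJet_comp (q := q) hηx hξ)
  have hr := hr1.clm_apply hr2
  have heq : (fun t : ℝ => gen N (N.lam (u, idJet E q + t • a)) (posJet q η (x + t • ξ x)))
      =ᶠ[𝓝 0] fun t => fderiv ℝ N.lam (u, idJet E q + t • a)
        (0, posJet q (fun y => η (y + t • ξ y)) x) := by
    have hη' : ∀ᶠ t : ℝ in 𝓝 0, ContDiffAt ℝ ∞ η (x + t • ξ x) := by
      refine hline.continuousAt.eventually ?_
      simpa only [hx0] using hη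
    filter_upwards [hη', eventually_add_smul_mem_dom N hid a] with t h1 h2
    have e1 : posJet q (fun y => y + t • ξ y) x = idJet E q + t • a := posJet_id_add_smul t hξ
    have h := fderiv_lam_comp_left N (q := q) (u := u) (φ := fun y => y + t • ξ y) (η := η) (x := x)
      (contDiffAt_id.add (contDiffAt_const.smul hξ)) h1 (by rwa [e1])
    rwa [e1] at h
  have h := hl.unique (hr.congr_of_eventuallyEq heq)
  simpa [hlam0, gen_apply N hu, N.lam_id u hu] using h

/-- The generators form a Lie algebra: this is the infinitesimal form of the compatibility of the
lifting with composition. -/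
theorem gen_posJet_lieBracket (N : NaturalBundle E F q) {u : F} (hu : u ∈ N.carrier) {ξ η : E → E}
    {x : E} (hξ : ∀ᶠ y in 𝓝 x, ContDiffAt ℝ ∞ ξ y) (hη : ∀ᶠ y in 𝓝 x, ContDiffAt ℝ ∞ η y) :
    gen N u (posJet q (VectorField.lieBracket ℝ ξ η) x)
      = fderiv ℝ (gen N) u (gen N u (posJet q ξ x)) (posJet q η x)
        - fderiv ℝ (gen N) u (gen N u (posJet q η x)) (posJet q ξ x)
        + gen N u (fderiv ℝ (posJet q η) x (ξ x)) - gen N u (fderiv ℝ (posJet q ξ) x (η x)) := by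
  have hξx := hξ.self_of_nhds
  have hηx := hη.self_of_nhds
  have h1 := fderiv_gen_gen N (q := q) hu hξx hη
  have h2 := fderiv_gen_gen N (q := q) hu hηx hξ
  rw [fderiv_fderiv_lam_symm N (N.id_mem u hu)] at h2
  have hs {f g : E → E} (hf : ContDiffAt ℝ ∞ f x) (hg : ContDiffAt ℝ ∞ g x) :
      ContDiffAt ℝ ∞ (fun y => fderiv ℝ f y (g y)) x :=
    (hf.fderiv_right (m := ∞) (by simp)).clm_apply hg
  have h3 : posJet q (VectorField.lieBracket ℝ ξ η) x
      = posJet q (fun y => fderiv ℝ η y (ξ y)) x - posJet q (fun y => fderiv ℝ ξ y (η y)) x :=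
    posJet_sub (hs hηx hξx) (hs hξx hηx)
  rw [h3, map_sub, ← sub_eq_of_eq_add' h1, ← sub_eq_of_eq_add' h2]
  abel

end Action

/-! ### Existence of infinitesimal label transformations -/

section Labels

variable {E F : Type*} [NormedAddCommGroup E] [NormedSpace ℝ E]
  [NormedAddCommGroup F] [NormedSpace ℝ F] {q : ℕ}

theorem iteratedFDeriv_id_zero (n : ℕ) (v : Fin (n + 1) → E) :
    iteratedFDeriv ℝ (n + 1) (fun y : E => y) 0 v = if n = 0 then v 0 else 0 := by
  rw [iteratedFDeriv_succ_apply_right]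
  simp only [fderiv_fun_id]
  cases n with
  | zero => simp
  | succ n => simp [iteratedFDeriv_const_of_ne]

theorem polyMap_idJet (y : E) : polyMap (idJet E (q + 1)) y = y := by
  have h (i : Fin (q + 1)) (v : Fin (i + 1) → E) :
      (idJet E (q + 1)).1 i v = ((Nat.factorial (i + 1) : ℕ) : ℝ)⁻¹ •
        ∑ τ : Equiv.Perm (Fin (i + 1)), if (i : ℕ) = 0 then v (τ 0) else 0 := by
    rw [idJet, posJet_apply]
    simp only [iteratedFDeriv_id_zero, Function.comp]
  simp only [polyMap, taylorRep, sub_zero, zero_add]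
  rw [Fin.sum_univ_succ, h]
  simp only [h]
  simp only [Fin.val_zero, Fin.val_succ, Nat.succ_ne_zero, if_true, if_false,
    Finset.sum_const_zero, smul_zero, Finset.sum_const, add_zero, Nat.factorial, Nat.cast_one,
    inv_one, one_smul, mul_one]
  exact one_nsmul y

theorem contDiffAt_fderiv_polyMap_apply (p a : PosJet E q) :
    ContDiffAt ℝ ∞ (fun y => fderiv ℝ (polyMap p) y (polyMap a y)) 0 :=
  ((contDiff_polyMap p).contDiffAt.fderiv_right (m := ∞) (by simp)).clm_apply
    (contDiff_polyMap a).contDiffAt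

/-- The derivative at the identity, in the direction `a`, of the composition of jets
`b ↦ p ∘ b`. -/
noncomputable def rightTranslation (q : ℕ) :
    PosJet E q →ₗ[ℝ] PosJet E q →ₗ[ℝ] PosJet E q :=
  LinearMap.mk₂ ℝ (fun p a => posJet q (fun y => fderiv ℝ (polyMap p) y (polyMap a y)) 0)
    (by
      intro p p' a
      rw [← posJet_add (contDiffAt_fderiv_polyMap_apply p a) (contDiffAt_fderiv_polyMap_apply p' a)]
      congr 1
      funext y
      have h : polyMap (p + p') = fun y => polyMap p y + polyMap p' y := funext (polyMap_add p p')
      rw [h, fderiv_fun_add ((contDiff_polyMap p).differentiable (by simp) y)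
        ((contDiff_polyMap p').differentiable (by simp) y)]
      rfl)
    (by
      intro c p a
      rw [← posJet_const_smul c (contDiffAt_fderiv_polyMap_apply p a)]
      congr 1
      funext y
      have h : polyMap (c • p) = fun y => c • polyMap p y := funext (polyMap_smul c p)
      rw [h, fderiv_fun_const_smul ((contDiff_polyMap p).differentiable (by simp) y)]
      rfl)
    (by
      intro p a a'
      rw [← posJet_add (contDiffAt_fderiv_polyMap_apply p a) (contDiffAt_fderiv_polyMap_apply p a')]
      simp only [polyMap_add, map_add])
    (by
      intro c p a
      rw [← posJet_const_smul c (contDiffAt_fderiv_polyMap_apply p a)]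
      simp only [polyMap_smul, map_smul])

theorem rightTranslation_apply (p a : PosJet E q) :
    rightTranslation q p a = posJet q (fun y => fderiv ℝ (polyMap p) y (polyMap a y)) 0 := rfl

theorem rightTranslation_idJet [FiniteDimensional ℝ E] (a : PosJet E q) : rightTranslation q (idJet E q) a = a := by
  -- for `q = 0` there are no jets of positive order, and `polyMap` vanishes
  cases q with
  | zero => exact PosJet.ext fun i => i.elim0
  | succ q =>
    have h : polyMap (idJet E (q + 1)) = fun y => y := funext polyMap_idJet
    rw [rightTranslation_apply, h]
    simp only [fderiv_fun_id, ContinuousLinearMap.id_apply]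
    exact posJet_polyMap a

/-- Maps depending continuously on a parameter stay invertible near a parameter where they are
the identity. -/
theorem eventually_bijective {P G : Type*} [TopologicalSpace P] [NormedAddCommGroup G]
    [NormedSpace ℝ G] [CompleteSpace G] {A : P → G →L[ℝ] G} {p₀ : P} (hA : ContinuousAt A p₀)
    (h₀ : A p₀ = ContinuousLinearMap.id ℝ G) :
    ∀ᶠ p in 𝓝 p₀, ∃ e : G ≃L[ℝ] G, (e : G →L[ℝ] G) = A p := by
  have h : range ((↑) : (G ≃L[ℝ] G) → G →L[ℝ] G) ∈ 𝓝 (A p₀) := by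
    rw [h₀]
    exact (ContinuousLinearEquiv.refl ℝ G).nhds
  exact hA h

theorem eventually_surjective_rightTranslation [FiniteDimensional ℝ E] :
    ∀ᶠ p in 𝓝 (idJet E q), Function.Surjective (rightTranslation (E := E) q p) := by
  have hc : Continuous fun p : PosJet E q => LinearMap.toContinuousLinearMap
      (rightTranslation (E := E) q p) :=
    LinearMap.continuous_of_finiteDimensional
      ((LinearMap.toContinuousLinearMap (𝕜 := ℝ) (E := PosJet E q)
        (F' := PosJet E q)).toLinearMap ∘ₗ rightTranslation (E := E) q)
  have : CompleteSpace (PosJet E q) := FiniteDimensional.complete ℝ _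
  filter_upwards [eventually_bijective hc.continuousAt
    (ContinuousLinearMap.ext rightTranslation_idJet)] with p ⟨e, he⟩ b
  obtain ⟨a, ha⟩ := e.surjective b
  exact ⟨a, by rw [← ha]; exact (congrArg (fun A : PosJet E q →L[ℝ] PosJet E q => A a) he).symm⟩

/-- Moving the starting point of the action infinitesimally amounts to composing the jet on the
right. -/
theorem fderiv_lam_comp_right [FiniteDimensional ℝ E] (N : NaturalBundle E F q) {u : F} {p : PosJet E q}
    (hz : (u, p) ∈ N.dom) (a : PosJet E q) :
    fderiv ℝ N.lam (u, p) (gen N u a, 0) = fderiv ℝ N.lam (u, p) (0, rightTranslation q p a) := by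
  have hu := N.fst_mem _ hz
  have hid := N.id_mem u hu
  have hP : ContDiffAt ℝ ∞ (polyMap p) 0 := (contDiff_polyMap p).contDiffAt
  have hA : ContDiffAt ℝ ∞ (polyMap a) 0 := (contDiff_polyMap a).contDiffAt
  have h1 : HasDerivAt (fun t : ℝ => (N.lam (u, idJet E q + t • a), p)) (gen N u a, 0) 0 := by
    have h := hasDerivAt_lam_add_smul N hid a
    rw [← gen_apply N hu] at h
    exact h.prodMk (hasDerivAt_const _ _)
  have h2 : HasDerivAt (fun t : ℝ => (u, posJet q (fun y => polyMap p (y + t • polyMap a y)) 0))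
      (0, rightTranslation q p a) 0 :=
    (hasDerivAt_const _ _).prodMk (hasDerivAt_posJet_comp hP hA)
  have e1 : (N.lam (u, idJet E q + (0 : ℝ) • a), p) = (u, p) := by simp [N.lam_id u hu]
  have e2 : (u, posJet q (fun y => polyMap p (y + (0 : ℝ) • polyMap a y)) 0) = (u, p) := by
    simp only [zero_smul, add_zero]
    exact congrArg (Prod.mk u) (posJet_polyMap p)
  have h1' := HasFDerivAt.comp_hasDerivAt (0 : ℝ) (by rw [e1]; exact hasFDerivAt_lam N hz) h1
  have h2' := HasFDerivAt.comp_hasDerivAt (0 : ℝ) (by rw [e2]; exact hasFDerivAt_lam N hz) h2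
  refine h1'.unique (h2'.congr_of_eventuallyEq ?_)
  have hm1 : ∀ᶠ t : ℝ in 𝓝 0, (N.lam (u, idJet E q + t • a), p) ∈ N.dom :=
    h1.continuousAt.eventually_mem (N.isOpen_dom.mem_nhds (by rwa [e1]))
  have hm2 : ∀ᶠ t : ℝ in 𝓝 0,
      (u, posJet q (fun y => polyMap p (y + t • polyMap a y)) 0) ∈ N.dom :=
    h2.continuousAt.eventually_mem (N.isOpen_dom.mem_nhds (by rwa [e2]))
  filter_upwards [hm1, hm2, eventually_add_smul_mem_dom N hid a] with t ht1 ht2 ht3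
  have e3 : posJet q (fun y => y + t • polyMap a y) 0 = idJet E q + t • a := by
    rw [posJet_id_add_smul t hA, posJet_polyMap]
  have e4 : (0 : E) + t • polyMap a 0 = 0 := by simp [polyMap_zero]
  have h := N.lam_comp (fun y => y + t • polyMap a y) (polyMap p) 0 u
    (contDiffAt_id.add (contDiffAt_const.smul hA)) (by simpa only [e4] using hP)
  simp only [e4, e3, posJet_polyMap] at h
  exact h ht3 ht1 ht2

/-- A family of right inverses of the generators that depends smoothly on the point of the
fibre. -/
theorem exists_rightInverse_gen [FiniteDimensional ℝ F] (N : NaturalBundle E F q) {u : F}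
    (hu : u ∈ N.carrier) (hs : Function.Surjective (gen N u)) :
    ∃ ρ : F → F →L[ℝ] PosJet E q,
      ∀ᶠ v in 𝓝 u, ContDiffAt ℝ ∞ ρ v ∧ ∀ h, gen N v (ρ v h) = h := by
  have : CompleteSpace F := FiniteDimensional.complete ℝ F
  obtain ⟨R', hR'⟩ := (gen N u : PosJet E q →ₗ[ℝ] F).exists_rightInverse_of_surjective
    (LinearMap.range_eq_top.2 hs)
  set R : F →L[ℝ] PosJet E q := LinearMap.toContinuousLinearMap R' with hR
  have hA {v : F} (hv : v ∈ N.carrier) : ContDiffAt ℝ ∞ (fun v => (gen N v).comp R) v :=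
    (contDiffAt_gen N hv).clm_comp contDiffAt_const
  have h0 : (gen N u).comp R = ContinuousLinearMap.id ℝ F :=
    ContinuousLinearMap.ext fun h => congrArg (fun A : F →ₗ[ℝ] F => A h) hR'
  refine ⟨fun v => R.comp (ContinuousLinearMap.inverse ((gen N v).comp R)), ?_⟩
  filter_upwards [eventually_bijective (hA hu).continuousAt h0,
    N.isOpen_carrier.mem_nhds hu] with v ⟨e, he⟩ hv
  constructor
  · refine contDiffAt_const.clm_comp ?_
    have hi := contDiffAt_map_inverse (𝕜 := ℝ) (n := ∞) e
    rw [he] at hi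
    exact hi.comp v (hA hv)
  · intro h
    have h1 : (gen N v).comp R (e.symm h) = h := by
      rw [← he]; exact e.apply_symm_apply h
    rw [← he, ContinuousLinearMap.inverse_equiv]
    exact h1

/-- If the generators span the tangent space of the fibre at `u`, then the orbit map
`p ↦ lam (u, p)` has a smooth section near `u`. -/
theorem exists_section_orbit [FiniteDimensional ℝ F] (N : NaturalBundle E F q) {u : F}
    (hu : u ∈ N.carrier) (hs : Function.Surjective (gen N u)) :
    ∃ s : F → PosJet E q, s u = idJet E q ∧
      ∀ᶠ v in 𝓝 u, ContDiffAt ℝ ∞ s v ∧ (u, s v) ∈ N.dom ∧ N.lam (u, s v) = v := by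
  have : CompleteSpace F := FiniteDimensional.complete ℝ F
  have hid := N.id_mem u hu
  obtain ⟨R', hR'⟩ := (gen N u : PosJet E q →ₗ[ℝ] F).exists_rightInverse_of_surjective
    (LinearMap.range_eq_top.2 hs)
  set R : F →L[ℝ] PosJet E q := LinearMap.toContinuousLinearMap R' with hR
  set g : F → F × PosJet E q := fun h => (u, idJet E q + R h) with hg
  have hgs : ContDiff ℝ ∞ g := contDiff_const.prodMk (contDiff_const.add R.contDiff)
  have hg0 : g 0 = (u, idJet E q) := by simp [hg]
  have hgd (h : F) : HasFDerivAt g ((0 : F →L[ℝ] F).prod R) h :=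
    (hasFDerivAt_const u h).prodMk (R.hasFDerivAt.const_add _)
  have hdom : ∀ᶠ h in 𝓝 (0 : F), g h ∈ N.dom :=
    hgs.continuous.continuousAt.eventually_mem (N.isOpen_dom.mem_nhds (by rwa [hg0]))
  set f : F → F := fun h => N.lam (g h) with hf
  have hfs {h : F} (hh : g h ∈ N.dom) : ContDiffAt ℝ ∞ f h :=
    (contDiffAt_lam N hh).comp h hgs.contDiffAt
  have hfd {h : F} (hh : g h ∈ N.dom) :
      HasFDerivAt f ((fderiv ℝ N.lam (g h)).comp ((0 : F →L[ℝ] F).prod R)) h :=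
    (hasFDerivAt_lam N hh).comp h (hgd h)
  have hA0 : (fderiv ℝ N.lam (g 0)).comp ((0 : F →L[ℝ] F).prod R)
      = ContinuousLinearMap.id ℝ F := by
    ext h
    have h1 : gen N u (R h) = h := congrArg (fun A : F →ₗ[ℝ] F => A h) hR'
    rw [gen_apply N hu] at h1
    rw [hg0]
    exact h1
  have hAc : ContinuousAt (fun h => (fderiv ℝ N.lam (g h)).comp ((0 : F →L[ℝ] F).prod R)) 0 := by
    have h1 : ContinuousAt (fun h => fderiv ℝ N.lam (g h)) 0 := by
      refine ContinuousAt.comp (g := fderiv ℝ N.lam) ?_ hgs.continuous.continuousAt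
      rw [hg0]
      exact (contDiffAt_fderiv_lam N hid).continuousAt
    exact h1.clm_comp continuousAt_const
  have hequiv := eventually_bijective hAc hA0
  have h0dom : g 0 ∈ N.dom := by rwa [hg0]
  have hf0 : f 0 = u := by simp only [hf, hg0]; exact N.lam_id u hu
  have hfd0 : HasFDerivAt f ((ContinuousLinearEquiv.refl ℝ F : F ≃L[ℝ] F) : F →L[ℝ] F) 0 := by
    have h := hfd h0dom
    rwa [hA0] at h
  set Φ := (hfs h0dom).toOpenPartialHomeomorph f hfd0 (by simp) with hΦ
  have hΦf : (Φ : F → F) = f := (hfs h0dom).toOpenPartialHomeomorph_coe hfd0 (by simp)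
  have h0s : (0 : F) ∈ Φ.source := (hfs h0dom).mem_toOpenPartialHomeomorph_source hfd0 (by simp)
  have hut : u ∈ Φ.target := by
    have h := Φ.map_source h0s
    rwa [hΦf, hf0] at h
  have hsu : Φ.symm u = 0 := by
    have h := Φ.left_inv h0s
    rwa [hΦf, hf0] at h
  have hsc : ContinuousAt Φ.symm u := Φ.continuousAt_symm hut
  refine ⟨fun v => idJet E q + R (Φ.symm v), by simp [hsu], ?_⟩
  filter_upwards [Φ.open_target.mem_nhds hut, hsc.eventually (by rw [hsu]; exact hdom),
    hsc.eventually (by rw [hsu]; exact hequiv)] with v hv hvd ⟨e, he⟩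
  refine ⟨?_, hvd, ?_⟩
  · have h1 : ContDiffAt ℝ ∞ Φ.symm v := by
      refine Φ.contDiffAt_symm (f₀' := e) hv ?_ ?_
      · rw [hΦf, he]; exact hfd hvd
      · rw [hΦf]; exact hfs hvd
    exact contDiffAt_const.add (R.contDiff.contDiffAt.comp v h1)
  · have h := Φ.right_inv hv
    rw [hΦf] at h
    exact h

theorem isInfinitesimalLabel_fderiv {N : NaturalBundle E F q} {V : Set F} {W : F → F}
    (hW : IsInfinitesimalLabel N V W) (hVN : V ⊆ N.carrier) {v : F} (hv : v ∈ V)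
    (a : PosJet E q) : fderiv ℝ W v (gen N v a) = fderiv ℝ (gen N) v (W v) a := by
  have h := hW.2 a v hv
  rw [VectorField.lieBracket, fderiv_gen_apply N (hVN hv), sub_eq_zero] at h
  exact h.symm

/-- The key point of the existence of label transformations. Let `s` be a section of the orbit
map `p ↦ lam (u, p)` and transport a vector `w` at `u` by the derivative of `lam (·, p)`. If `w`
is fixed by the isotropy of `u`, then the resulting vector field commutes with the generators. -/
theorem fderiv_transport [FiniteDimensional ℝ E] (N : NaturalBundle E F q) {u v w : F}
    {s : F → PosJet E q} (hs : DifferentiableAt ℝ s v) (hdom : (u, s v) ∈ N.dom)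
    (hsec : ∀ᶠ v' in 𝓝 v, N.lam (u, s v') = v')
    (hinj : ∀ h, fderiv ℝ N.lam (u, s v) (h, 0) = 0 → h = 0)
    (hsurj : Function.Surjective (rightTranslation (E := E) q (s v)))
    (hw : ∀ a, gen N u a = 0 → fderiv ℝ (gen N) u w a = 0) (a : PosJet E q) :
    fderiv ℝ (fun v' => fderiv ℝ N.lam (u, s v') (w, 0)) v (gen N v a)
      = fderiv ℝ (gen N) v (fderiv ℝ N.lam (u, s v) (w, 0)) a := by
  set p := s v with hp
  set ds := fderiv ℝ s v with hds
  have hu := N.fst_mem _ hdom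
  have hlam : N.lam (u, p) = v := hsec.self_of_nhds
  have hv : v ∈ N.carrier := hlam ▸ N.lam_mem _ hdom
  have hcurve : HasFDerivAt (fun v' => (u, s v')) ((0 : F →L[ℝ] F).prod ds) v :=
    (hasFDerivAt_const u v).prodMk hs.hasFDerivAt
  have hsec' (h : F) : fderiv ℝ N.lam (u, p) (0, ds h) = h := by
    have h1 : HasFDerivAt (fun v' => N.lam (u, s v')) _ v :=
      (hasFDerivAt_lam N hdom).comp v hcurve
    have h2 := h1.unique ((hasFDerivAt_id v).congr_of_eventuallyEq hsec)
    exact congrArg (fun A : F →L[ℝ] F => A h) h2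
  have hW (h : F) : fderiv ℝ (fun v' => fderiv ℝ N.lam (u, s v') (w, 0)) v h
      = fderiv ℝ (fderiv ℝ N.lam) (u, p) (0, ds h) (w, 0) := by
    have h1 : HasFDerivAt (fun v' => fderiv ℝ N.lam (u, s v')) _ v :=
      (hasFDerivAt_fderiv_lam N hdom).comp v hcurve
    rw [(h1.clm_apply (hasFDerivAt_const ((w, 0) : F × PosJet E q) v)).fderiv]
    simp
  have hleft : HasFDerivAt (fun u' : F => (u', p)) (ContinuousLinearMap.inl ℝ F (PosJet E q)) u :=
    hasFDerivAt_prodMk_left u p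
  have hD : HasFDerivAt (fun u' => fderiv ℝ N.lam (u', p)) _ u :=
    (hasFDerivAt_fderiv_lam N hdom).comp u hleft
  have hdom' : ∀ᶠ u' in 𝓝 u, (u', p) ∈ N.dom :=
    hleft.continuousAt.eventually_mem (N.isOpen_dom.mem_nhds hdom)
  -- differentiate `fderiv_lam_comp_left` with respect to `u`
  set c := posJet q (fun y => polyMap a (polyMap p y)) (0 : E) with hc
  have hpost {u' : F} (hu' : (u', p) ∈ N.dom) :
      gen N (N.lam (u', p)) a = fderiv ℝ N.lam (u', p) (0, c) := by
    have h := fderiv_lam_comp_left N (u := u') (φ := polyMap p) (η := polyMap a) (x := 0)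
      (contDiff_polyMap p).contDiffAt (contDiff_polyMap a).contDiffAt
      (by rwa [posJet_polyMap])
    rwa [polyMap_zero, posJet_polyMap, posJet_polyMap] at h
  have hpost' : fderiv ℝ (gen N) v (fderiv ℝ N.lam (u, p) (w, 0)) a
      = fderiv ℝ (fderiv ℝ N.lam) (u, p) (w, 0) (0, c) := by
    have h1 : HasFDerivAt (fun u' => N.lam (u', p)) _ u := (hasFDerivAt_lam N hdom).comp u hleft
    have hg : HasFDerivAt (gen N) (fderiv ℝ (gen N) v) (N.lam (u, p)) := by
      rw [hlam]; exact hasFDerivAt_gen N hv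
    have h2 : HasFDerivAt (fun u' => gen N (N.lam (u', p))) _ u :=
      HasFDerivAt.comp (g := gen N) u hg h1
    have h3 := h2.clm_apply (hasFDerivAt_const a u)
    have h4 := (hD.clm_apply (hasFDerivAt_const ((0, c) : F × PosJet E q) u)).congr_of_eventuallyEq
      (hdom'.mono fun u' hu' => hpost hu')
    have h5 := congrArg (fun A : F →L[ℝ] F => A w) (h3.unique h4)
    simpa using h5
  -- the difference of the two directions at `p` is tangent to the fibre of the orbit map
  obtain ⟨a', ha'⟩ := hsurj (ds (gen N v a) - c)
  have hker : fderiv ℝ N.lam (u, p) (0, ds (gen N v a) - c) = 0 := by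
    have h1 : ((0 : F), ds (gen N v a) - c) = (0, ds (gen N v a)) - (0, c) := by simp
    rw [h1, map_sub, hsec', ← hpost hdom, hlam, sub_self]
  have hiso : gen N u a' = 0 :=
    hinj _ (by rw [fderiv_lam_comp_right N hdom, ha', hker])
  have hpre : fderiv ℝ (fderiv ℝ N.lam) (u, p) (w, 0) (0, ds (gen N v a) - c) = 0 := by
    have h1 : HasFDerivAt (fun u' => ((gen N u' a', 0) : F × PosJet E q)) _ u :=
      ((hasFDerivAt_gen N hu).clm_apply (hasFDerivAt_const a' u)).prodMk
        (hasFDerivAt_const (0 : PosJet E q) u)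
    have h3 := hD.clm_apply h1
    have h4 : HasFDerivAt (fun u' => fderiv ℝ N.lam (u', p) (gen N u' a', 0)) _ u :=
      (hD.clm_apply (hasFDerivAt_const
      ((0, ds (gen N v a) - c) : F × PosJet E q) u)).congr_of_eventuallyEq
      (hdom'.mono fun u' hu' => by
        have h := fderiv_lam_comp_right N hu' a'
        rwa [ha'] at h)
    have h5 := congrArg (fun A : F →L[ℝ] F => A w) (h3.unique h4)
    have h00 : ((0 : F), (0 : PosJet E q)) = 0 := rfl
    simp [hiso, hw a' hiso, h00] at h5
    simpa using h5.symm
  have hsplit : ((0 : F), ds (gen N v a)) = (0, ds (gen N v a) - c) + (0, c) := by simp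
  rw [hW, fderiv_fderiv_lam_symm N hdom, hsplit, map_add, hpre, zero_add, hpost']

/-- Near a point `u` where the generators span the tangent space of the fibre, every vector at
`u` that is fixed by the isotropy of `u` is the value of an infinitesimal label transformation,
on a neighbourhood that does not depend on the vector. -/
theorem exists_label_nhds [FiniteDimensional ℝ E] [FiniteDimensional ℝ F]
    (N : NaturalBundle E F q) {u : F} (hu : u ∈ N.carrier)
    (hs : Function.Surjective (gen N u)) :
    ∃ V₀ ∈ 𝓝 u, V₀ ⊆ N.carrier ∧ (∀ v ∈ V₀, Function.Surjective (gen N v)) ∧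
      ∀ w, (∀ a, gen N u a = 0 → fderiv ℝ (gen N) u w a = 0) →
        ∃ W, W u = w ∧ IsInfinitesimalLabel N V₀ W := by
  have : CompleteSpace F := FiniteDimensional.complete ℝ F
  obtain ⟨s, hsu, hsec⟩ := exists_section_orbit N hu hs
  obtain ⟨ρ, hρ⟩ := exists_rightInverse_gen N hu hs
  have hsc : ContinuousAt s u := hsec.self_of_nhds.1.continuousAt
  have hB : ∀ᶠ v in 𝓝 u, Function.Surjective (rightTranslation (E := E) q (s v)) :=
    hsc.eventually (by rw [hsu]; exact eventually_surjective_rightTranslation)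
  have hid := N.id_mem u hu
  have hA : ContinuousAt (fun v => (fderiv ℝ N.lam (u, s v)).comp
      (ContinuousLinearMap.inl ℝ F (PosJet E q))) u := by
    have h1 : ContinuousAt (fun v => fderiv ℝ N.lam (u, s v)) u := by
      refine ContinuousAt.comp (g := fderiv ℝ N.lam) ?_ (continuousAt_const.prodMk hsc)
      rw [hsu]
      exact (contDiffAt_fderiv_lam N hid).continuousAt
    exact h1.clm_comp continuousAt_const
  have hI := eventually_bijective hA (by
    ext w
    rw [hsu]
    exact fderiv_lam_id_fst N hu w)
  have hall := (hsec.and (hρ.and (hB.and (hI.and (N.isOpen_carrier.mem_nhds hu))))).eventually_nhds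
  refine ⟨_, hall, fun v hv => (Filter.Eventually.self_of_nhds hv).2.2.2.2, fun v hv h => ?_,
    fun w hw => ⟨fun v => fderiv ℝ N.lam (u, s v) (w, 0), ?_, ?_, ?_⟩⟩
  · exact ⟨_, (Filter.Eventually.self_of_nhds hv).2.1.2 h⟩
  · simp only [hsu]
    exact fderiv_lam_id_fst N hu w
  · intro v hv
    obtain ⟨hsv, hdom, -⟩ := (Filter.Eventually.self_of_nhds hv).1
    have h1 : ContDiffAt ℝ ∞ (fun v => fderiv ℝ N.lam (u, s v)) v :=
      ContDiffAt.comp v (contDiffAt_fderiv_lam N hdom) (contDiffAt_const.prodMk hsv)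
    exact (h1.clm_apply contDiffAt_const).contDiffWithinAt
  · intro a v hv
    obtain ⟨⟨hsv, hdom, -⟩, -, hBv, ⟨e, he⟩, hvN⟩ := Filter.Eventually.self_of_nhds hv
    have h := fderiv_transport N (hsv.differentiableAt (by simp)) hdom
      (Filter.Eventually.mono hv fun v' h => h.1.2.2) (fun h h0 => ?_) hBv hw a
    · rw [VectorField.lieBracket, fderiv_gen_apply N hvN, h, sub_self]
    · have h1 : e h = (fderiv ℝ N.lam (u, s v)).comp
        (ContinuousLinearMap.inl ℝ F (PosJet E q)) h := by rw [← he]; rfl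
      exact e.map_eq_zero_iff.1 (h1.trans h0)

/-! ### Unique continuation -/

/-- A map on a connected open set that vanishes at one point and whose derivative is bounded,
locally, by a multiple of the map itself vanishes identically. -/
theorem eq_zero_of_fderiv_bound {G H : Type*} [NormedAddCommGroup G] [NormedSpace ℝ G]
    [NormedAddCommGroup H] [NormedSpace ℝ H] {Y : Set G} (hY : IsOpen Y) (hYc : IsPreconnected Y)
    {f : G → H} (hf : DifferentiableOn ℝ f Y)
    (hb : ∀ x ∈ Y, ∃ K : ℝ, ∀ᶠ y in 𝓝 x, ‖fderiv ℝ f y‖ ≤ K * ‖f y‖)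
    {x₀ : G} (hx₀ : x₀ ∈ Y) (h0 : f x₀ = 0) : ∀ x ∈ Y, f x = 0 := by
  -- near each point of `Y`, all values vanish as soon as one of them does
  have hloc (x) (hx : x ∈ Y) : ∃ r > 0, Metric.ball x r ⊆ Y ∧ ∀ y ∈ Metric.ball x r, f y = 0 →
      ∀ z ∈ Metric.ball x r, f z = 0 := by
    obtain ⟨K, hK⟩ := hb x hx
    obtain ⟨r, hr, hball⟩ := Metric.mem_nhds_iff.1 (Filter.inter_mem (hY.mem_nhds hx) hK)
    refine ⟨r, hr, fun y hy => (hball hy).1, fun y hy hfy z hz => ?_⟩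
    have hseg (t : ℝ) (ht : t ∈ Icc (0 : ℝ) 1) : y + t • (z - y) ∈ Metric.ball x r :=
      (convex_ball x r).add_smul_sub_mem hy hz ht
    have hd (t : ℝ) (ht : t ∈ Icc (0 : ℝ) 1) : HasDerivAt (fun t : ℝ => f (y + t • (z - y)))
        (fderiv ℝ f (y + t • (z - y)) (z - y)) t := by
      have h1 : HasDerivAt (fun t : ℝ => y + t • (z - y)) (z - y) t := by
        simpa using ((hasDerivAt_id t).smul_const (z - y)).const_add y
      have hmem := (hball (hseg t ht)).1
      exact ((hf _ hmem).differentiableAt (hY.mem_nhds hmem)).hasFDerivAt.comp_hasDerivAt t h1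
    have h := eq_zero_of_abs_deriv_le_mul_abs_self_of_eq_zero_right
      (f := fun t : ℝ => f (y + t • (z - y))) (K := K * ‖z - y‖) (a := 0) (b := 1)
      (fun t ht => (hd t ht).continuousAt.continuousWithinAt)
      (fun t ht => (hd t (Ico_subset_Icc_self ht)).hasDerivWithinAt) (by simpa using hfy)
      (fun t ht => by
        refine (ContinuousLinearMap.le_opNorm _ _).trans ?_
        have h2 := (hball (hseg t (Ico_subset_Icc_self ht))).2
        calc _ ≤ (K * ‖f (y + t • (z - y))‖) * ‖z - y‖ :=
              mul_le_mul_of_nonneg_right h2 (norm_nonneg _)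
          _ = _ := by ring)
      1 (by simp)
    simpa using h
  have hsub : Y ⊆ {x | ∀ᶠ y in 𝓝 x, f y = 0} := by
    refine hYc.subset_of_closure_inter_subset isOpen_setOfPred_eventually_nhds
      ⟨x₀, hx₀, ?_⟩ fun x ⟨hxc, hxY⟩ => ?_
    · obtain ⟨r, hr, -, h⟩ := hloc x₀ hx₀
      filter_upwards [Metric.ball_mem_nhds x₀ hr] with y hy
        using h x₀ (Metric.mem_ball_self hr) h0 y hy
    · obtain ⟨r, hr, -, h⟩ := hloc x hxY
      obtain ⟨y, hy, hyr⟩ := Metric.mem_closure_iff.1 hxc r hr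
      have hy0 : ∀ᶠ z in 𝓝 y, f z = 0 := hy
      have hyb : y ∈ Metric.ball x r := by rwa [Metric.mem_ball, dist_comm]
      filter_upwards [Metric.ball_mem_nhds x hr] with z hz
        using h y hyb hy0.self_of_nhds z hz
  exact fun x hx => (hsub hx).self_of_nhds

end Labels

section Invariants

variable {E F : Type*} [NormedAddCommGroup E] [NormedSpace ℝ E]
  [NormedAddCommGroup F] [NormedSpace ℝ F] {q : ℕ}

/-- Unique continuation for invariant fields along a map `ω` into the region where the generators
span the tangent space of the fibre. The case `ω = id` concerns the label transformations
themselves. -/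
theorem eq_zero_of_invariant [FiniteDimensional ℝ F] {G : Type*} [NormedAddCommGroup G]
    [NormedSpace ℝ G] (N : NaturalBundle E F q) {Y : Set G} (hY : IsOpen Y)
    (hYc : IsPreconnected Y) {ω₀ Ω : G → F} (hω : ContDiffOn ℝ ∞ ω₀ Y)
    (hωN : ∀ x ∈ Y, ω₀ x ∈ N.carrier) (hs : ∀ x ∈ Y, Function.Surjective (gen N (ω₀ x)))
    (hΩ : DifferentiableOn ℝ Ω Y)
    (hinv : ∀ x ∈ Y, ∀ ξ a, fderiv ℝ ω₀ x ξ = gen N (ω₀ x) a →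
      fderiv ℝ Ω x ξ = fderiv ℝ (gen N) (ω₀ x) (Ω x) a)
    {x₀ : G} (hx₀ : x₀ ∈ Y) (h0 : Ω x₀ = 0) : ∀ x ∈ Y, Ω x = 0 := by
  refine eq_zero_of_fderiv_bound hY hYc hΩ (fun x hx => ?_) hx₀ h0
  obtain ⟨ρ, hρ⟩ := exists_rightInverse_gen N (hωN x hx) (hs x hx)
  have hωx : ContDiffAt ℝ ∞ ω₀ x := hω.contDiffAt (hY.mem_nhds hx)
  set k : G → ℝ := fun y => ‖fderiv ℝ (gen N) (ω₀ y)‖ * ‖ρ (ω₀ y)‖ * ‖fderiv ℝ ω₀ y‖ with hk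
  have hkc : ContinuousAt k x := by
    have h1 := (ContDiffAt.comp x (g := fderiv ℝ (gen N))
      ((contDiffAt_gen N (hωN x hx)).fderiv_right (m := ∞) (by simp)) hωx).continuousAt
    have h2 := (ContDiffAt.comp x (g := ρ) hρ.self_of_nhds.1 hωx).continuousAt
    have h3 := (hωx.fderiv_right (m := ∞) (by simp)).continuousAt
    exact ((ContinuousAt.norm (E := F →L[ℝ] PosJet E q →L[ℝ] F) h1).mul h2.norm).mul h3.norm
  refine ⟨k x + 1, ?_⟩
  filter_upwards [hkc.eventually (eventually_le_nhds (lt_add_one (k x))),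
    hωx.continuousAt.eventually hρ, hY.mem_nhds hx] with y hky hρy hy
  refine ContinuousLinearMap.opNorm_le_bound _ ?_ fun ξ => ?_
  · have : 0 ≤ k x := by positivity
    positivity
  · rw [hinv y hy ξ (ρ (ω₀ y) (fderiv ℝ ω₀ y ξ)) (hρy.2 _).symm]
    calc _ ≤ ‖fderiv ℝ (gen N) (ω₀ y) (Ω y)‖ * ‖ρ (ω₀ y) (fderiv ℝ ω₀ y ξ)‖ :=
          ContinuousLinearMap.le_opNorm _ _
      _ ≤ (‖fderiv ℝ (gen N) (ω₀ y)‖ * ‖Ω y‖) * (‖ρ (ω₀ y)‖ * (‖fderiv ℝ ω₀ y‖ * ‖ξ‖)) := by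
          gcongr
          · exact ContinuousLinearMap.le_opNorm _ _
          · exact (ContinuousLinearMap.le_opNorm _ _).trans
              (mul_le_mul_of_nonneg_left (ContinuousLinearMap.le_opNorm _ _) (norm_nonneg _))
      _ = k y * (‖Ω y‖ * ‖ξ‖) := by simp only [hk]; ring
      _ ≤ (k x + 1) * (‖Ω y‖ * ‖ξ‖) := by gcongr
      _ = _ := by ring

theorem isInfinitesimalLabel_iff {N : NaturalBundle E F q} {V : Set F} {W : F → F}
    (hVN : V ⊆ N.carrier) :
    IsInfinitesimalLabel N V W ↔ ContDiffOn ℝ ∞ W V ∧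
      ∀ v ∈ V, ∀ a, fderiv ℝ W v (gen N v a) = fderiv ℝ (gen N) v (W v) a := by
  refine ⟨fun h => ⟨h.1, fun v hv a => isInfinitesimalLabel_fderiv h hVN hv a⟩,
    fun h => ⟨h.1, fun a v hv => ?_⟩⟩
  rw [VectorField.lieBracket, fderiv_gen_apply N (hVN hv), h.2 v hv, sub_self]

theorem IsInfinitesimalLabel.mono {N : NaturalBundle E F q} {V V' : Set F} {W : F → F}
    (h : IsInfinitesimalLabel N V' W) (hV : V ⊆ V') : IsInfinitesimalLabel N V W :=
  ⟨h.1.mono hV, fun a u hu => h.2 a u (hV hu)⟩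

theorem IsInfinitesimalLabel.sub {N : NaturalBundle E F q} {V : Set F} (hV : IsOpen V)
    (hVN : V ⊆ N.carrier) {W W' : F → F} (h : IsInfinitesimalLabel N V W)
    (h' : IsInfinitesimalLabel N V W') : IsInfinitesimalLabel N V fun u => W u - W' u := by
  rw [isInfinitesimalLabel_iff hVN] at h h' ⊢
  refine ⟨h.1.sub h'.1, fun v hv a => ?_⟩
  rw [fderiv_fun_sub ((h.1.contDiffAt (hV.mem_nhds hv)).differentiableAt (by simp))
    ((h'.1.contDiffAt (hV.mem_nhds hv)).differentiableAt (by simp))]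
  simp only [sub_apply, map_sub, h.2 v hv, h'.2 v hv]

theorem IsInfinitesimalLabel.sum_smul {N : NaturalBundle E F q} {V : Set F} (hV : IsOpen V)
    (hVN : V ⊆ N.carrier) {p : ℕ} {W : Fin p → F → F} (h : ∀ α, IsInfinitesimalLabel N V (W α))
    (A : Fin p → ℝ) : IsInfinitesimalLabel N V fun u => ∑ α, A α • W α u := by
  simp only [isInfinitesimalLabel_iff hVN] at h ⊢
  refine ⟨ContDiffOn.sum fun α _ => contDiffOn_const.smul (h α).1, fun v hv a => ?_⟩
  have hd (α : Fin p) : DifferentiableAt ℝ (W α) v :=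
    ((h α).1.contDiffAt (hV.mem_nhds hv)).differentiableAt (by simp)
  rw [fderiv_fun_sum (A := fun α u => A α • W α u) fun α _ => (hd α).const_smul (A α)]
  simp only [fderiv_fun_const_smul (hd _), sum_apply, smul_apply, (h _).2 v hv, map_sum, map_smul]

/-- A label transformation on a connected set is determined by its value at one point. -/
theorem IsInfinitesimalLabel.eq_zero [FiniteDimensional ℝ F] {N : NaturalBundle E F q} {V : Set F}
    (hV : IsOpen V) (hVc : IsPreconnected V) (hVN : V ⊆ N.carrier)
    (hs : ∀ v ∈ V, Function.Surjective (gen N v)) {W : F → F} (h : IsInfinitesimalLabel N V W)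
    {u : F} (hu : u ∈ V) (h0 : W u = 0) : ∀ v ∈ V, W v = 0 := by
  have h' := (isInfinitesimalLabel_iff hVN).1 h
  refine eq_zero_of_invariant N hV hVc (ω₀ := fun v => v) contDiffOn_id hVN hs
    (h.1.differentiableOn (by simp)) (fun v hv ξ a hξ => ?_) hu h0
  rw [← h'.2 v hv a, ← hξ]
  simp

/-- A system of infinitesimal generators of the label transformations: transport a basis of the
space of vectors fixed by the isotropy. -/
theorem exists_isLabelBasis [FiniteDimensional ℝ F] {N : NaturalBundle E F q} {V : Set F}
    (hV : IsOpen V) (hVc : IsPreconnected V) (hVN : V ⊆ N.carrier)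
    (hs : ∀ v ∈ V, Function.Surjective (gen N v)) {u : F} (hu : u ∈ V)
    (hex : ∀ w, (∀ a, gen N u a = 0 → fderiv ℝ (gen N) u w a = 0) →
      ∃ W, W u = w ∧ IsInfinitesimalLabel N V W) :
    ∃ p ≤ Module.finrank ℝ F, ∃ W : Fin p → F → F, IsLabelBasis N V W := by
  let K : Submodule ℝ F :=
    { carrier := {w | ∀ a, gen N u a = 0 → fderiv ℝ (gen N) u w a = 0}
      add_mem' := fun {w w'} h h' a ha => by
        rw [map_add, add_apply, h a ha, h' a ha, add_zero]
      zero_mem' := fun a _ => by rw [map_zero, zero_apply]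
      smul_mem' := fun c w h a ha => by rw [map_smul, smul_apply, h a ha, smul_zero] }
  let b := Module.finBasis ℝ K
  choose W hWu hW using fun α => hex (b α : F) (b α).2
  have hval (A : Fin (Module.finrank ℝ K) → ℝ) :
      ∑ α, A α • W α u = ((∑ α, A α • b α : K) : F) := by
    simp [hWu]
  refine ⟨_, Submodule.finrank_le K, W, hW, fun A hA => ?_, fun W' hW' => ?_⟩
  · have h : ∑ α, A α • b α = 0 := Subtype.ext ((hval A).symm.trans (hA u hu))
    exact funext (Fintype.linearIndependent_iff.1 b.linearIndependent A h)
  · have hmem : W' u ∈ K := fun a ha => by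
      rw [← isInfinitesimalLabel_fderiv hW' hVN hu a, ha, map_zero]
    refine ⟨b.repr ⟨W' u, hmem⟩, fun v hv => ?_⟩
    refine sub_eq_zero.1 ((hW'.sub hV hVN (.sum_smul hV hVN hW _)).eq_zero hV hVc hVN hs hu ?_ v hv)
    rw [hval, b.sum_repr, sub_self]

/-! ### Invariant sections -/

theorem mem_Rq {N : NaturalBundle E F q} {ω₀ : E → F} {x : E} {p : JetT E q} :
    p ∈ Rq N ω₀ x ↔ fderiv ℝ ω₀ x p.1 = gen N (ω₀ x) p.2 :=
  sub_eq_zero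

theorem lieSection_apply (N : NaturalBundle E F q) (ω₀ : E → F) (x : E) (p : JetT E q) :
    lieSection N ω₀ x p = fderiv ℝ ω₀ x p.1 - gen N (ω₀ x) p.2 := rfl

theorem lieVertical_eq (N : NaturalBundle E F q) {ω₀ : E → F} (Ω : E → F) {x : E}
    (hx : ω₀ x ∈ N.carrier) (p : JetT E q) :
    lieVertical N ω₀ Ω x p = fderiv ℝ Ω x p.1 - fderiv ℝ (gen N) (ω₀ x) (Ω x) p.2 := by
  rw [lieVertical, fderiv_gen_apply N hx]

/-- If `J_q(T) → F₀` is onto and `R_q` is transitive, then the generators span the tangent space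
of the fibre along the section. -/
theorem surjective_gen {N : NaturalBundle E F q} {ω₀ : E → F} {x : E}
    (htrans : ∀ ξ : E, ∃ a : PosJet E q, (ξ, a) ∈ Rq N ω₀ x)
    (hepi : Function.Surjective (lieSection N ω₀ x)) : Function.Surjective (gen N (ω₀ x)) := by
  intro h
  obtain ⟨p, hp⟩ := hepi h
  obtain ⟨a, ha⟩ := htrans p.1
  refine ⟨a - p.2, ?_⟩
  rw [map_sub, ← mem_Rq.1 ha]
  exact hp

/-- The invariant sections of `F₀` are the restrictions to `ω` of the label transformations. -/
theorem mem_Upsilon0_iff [FiniteDimensional ℝ F] {N : NaturalBundle E F q} {V : Set F}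
    (hV : IsOpen V) (hVN : V ⊆ N.carrier)
    (hs : ∀ v ∈ V, Function.Surjective (gen N v)) {Y : Set E} (hY : IsOpen Y)
    (hYc : IsPreconnected Y) {ω₀ : E → F} (hω : ContDiffOn ℝ ∞ ω₀ Y) (hωV : MapsTo ω₀ Y V)
    {x₀ : E} (hx₀ : x₀ ∈ Y)
    (hex : ∀ w, (∀ a, gen N (ω₀ x₀) a = 0 → fderiv ℝ (gen N) (ω₀ x₀) w a = 0) →
      ∃ W, W (ω₀ x₀) = w ∧ IsInfinitesimalLabel N V W)
    {p : ℕ} {W : Fin p → F → F} (hW : IsLabelBasis N V W) (Ω : E → F) :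
    Ω ∈ Upsilon0 N ω₀ Y ↔ ∃ A : Fin p → ℝ, ∀ x ∈ Y, Ω x = ∑ α, A α • W α (ω₀ x) := by
  have hωd {x : E} (hx : x ∈ Y) : ContDiffAt ℝ ∞ ω₀ x := hω.contDiffAt (hY.mem_nhds hx)
  have hlabel {U : F → F} (hU : IsInfinitesimalLabel N V U) {x : E} (hx : x ∈ Y) :
      HasFDerivAt (fun y => U (ω₀ y)) ((fderiv ℝ U (ω₀ x)).comp (fderiv ℝ ω₀ x)) x :=
    ((hU.1.contDiffAt (hV.mem_nhds (hωV hx))).differentiableAt (by simp)).hasFDerivAt.comp x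
      ((hωd hx).differentiableAt (by simp)).hasFDerivAt
  have hinv {U : F → F} (hU : IsInfinitesimalLabel N V U) {x : E} (hx : x ∈ Y) (ξ : E)
      (a : PosJet E q) (h : fderiv ℝ ω₀ x ξ = gen N (ω₀ x) a) :
      fderiv ℝ (fun y => U (ω₀ y)) x ξ = fderiv ℝ (gen N) (ω₀ x) (U (ω₀ x)) a := by
    rw [(hlabel hU hx).fderiv, ContinuousLinearMap.comp_apply, h]
    exact isInfinitesimalLabel_fderiv hU hVN (hωV hx) a
  constructor
  · rintro ⟨hΩs, hΩ⟩
    have hΩd {x : E} (hx : x ∈ Y) : DifferentiableAt ℝ Ω x :=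
      (hΩs.contDiffAt (hY.mem_nhds hx)).differentiableAt (by simp)
    have hΩ' (x) (hx : x ∈ Y) (ξ : E) (a : PosJet E q)
        (h : fderiv ℝ ω₀ x ξ = gen N (ω₀ x) a) :
        fderiv ℝ Ω x ξ = fderiv ℝ (gen N) (ω₀ x) (Ω x) a := by
      have h1 := hΩ x hx (ξ, a) (mem_Rq.2 h)
      rwa [lieVertical_eq N Ω (hVN (hωV hx)), sub_eq_zero] at h1
    obtain ⟨U, hU0, hU⟩ := hex (Ω x₀) fun a ha => by
      rw [← hΩ' x₀ hx₀ 0 a (by rw [ha, map_zero]), map_zero]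
    obtain ⟨A, hA⟩ := hW.spanning U hU
    refine ⟨A, fun x hx => ?_⟩
    rw [← hA _ (hωV hx), ← sub_eq_zero]
    refine eq_zero_of_invariant N (Ω := fun x => Ω x - U (ω₀ x)) hY hYc hω
      (fun x hx => hVN (hωV hx)) (fun x hx => hs _ (hωV hx))
      (fun x hx => ((hΩd hx).sub (hlabel hU hx).differentiableAt).differentiableWithinAt)
      (fun x hx ξ a h => ?_) hx₀ (by rw [hU0, sub_self]) x hx
    rw [fderiv_fun_sub (hΩd hx) (hlabel hU hx).differentiableAt, sub_apply, hΩ' x hx ξ a h,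
      hinv hU hx ξ a h, map_sub, sub_apply]
  · rintro ⟨A, hA⟩
    have hU := IsInfinitesimalLabel.sum_smul hV hVN hW.label A
    refine ⟨(hU.1.comp hω hωV).congr hA, fun x hx r hr => ?_⟩
    have heq : Ω =ᶠ[𝓝 x] fun y => ∑ α, A α • W α (ω₀ y) := by
      filter_upwards [hY.mem_nhds hx] with y hy using hA y hy
    rw [lieVertical_eq N Ω (hVN (hωV hx)), heq.fderiv_eq, hA x hx, sub_eq_zero]
    exact hinv hU hx r.1 r.2 (mem_Rq.1 hr)

/-! ### The normalizer -/

theorem contDiffAt_lieSection {N : NaturalBundle E F q} {ω₀ : E → F} {x : E}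
    (hω : ContDiffAt ℝ ∞ ω₀ x) (hx : ω₀ x ∈ N.carrier) {σ : E → JetT E q}
    (hσ : ContDiffAt ℝ ∞ σ x) : ContDiffAt ℝ ∞ (fun y => lieSection N ω₀ y (σ y)) x :=
  ((hω.fderiv_right (m := ∞) (by simp)).clm_apply hσ.fst).sub
    (((contDiffAt_gen N hx).comp x hω).clm_apply hσ.snd)

theorem fderiv_lieSection {N : NaturalBundle E F q} {ω₀ : E → F} {x : E}
    (hω : ContDiffAt ℝ ∞ ω₀ x) (hx : ω₀ x ∈ N.carrier) {σ : E → JetT E q}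
    (hσ : DifferentiableAt ℝ σ x) (v : E) :
    fderiv ℝ (fun y => lieSection N ω₀ y (σ y)) x v
      = fderiv ℝ (fderiv ℝ ω₀) x v (σ x).1
        - fderiv ℝ (gen N) (ω₀ x) (fderiv ℝ ω₀ x v) (σ x).2
        + lieSection N ω₀ x (fderiv ℝ σ x v) := by
  have h1 := ((hω.fderiv_right (m := ∞) (by simp)).differentiableAt
    (by simp)).hasFDerivAt.clm_apply hσ.hasFDerivAt.fst
  have h2 : HasFDerivAt (fun y => gen N (ω₀ y)) _ x :=
    HasFDerivAt.comp (g := gen N) x (hasFDerivAt_gen N hx)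
      (hω.differentiableAt (by simp)).hasFDerivAt
  have h3 : HasFDerivAt (fun y => lieSection N ω₀ y (σ y)) _ x :=
    h1.sub (h2.clm_apply hσ.hasFDerivAt.snd)
  rw [h3.fderiv, lieSection_apply]
  simp
  abel

theorem lieVertical_lieSection {N : NaturalBundle E F q} {ω₀ : E → F} {x : E}
    (hω : ContDiffAt ℝ ∞ ω₀ x) (hx : ω₀ x ∈ N.carrier) {σ : E → JetT E q}
    (hσ : DifferentiableAt ℝ σ x) (p : JetT E q) :
    lieVertical N ω₀ (fun y => lieSection N ω₀ y (σ y)) x p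
      = fderiv ℝ (fderiv ℝ ω₀) x p.1 (σ x).1
        - fderiv ℝ (gen N) (ω₀ x) (fderiv ℝ ω₀ x p.1) (σ x).2
        - fderiv ℝ (gen N) (ω₀ x) (fderiv ℝ ω₀ x (σ x).1) p.2
        + fderiv ℝ (gen N) (ω₀ x) (gen N (ω₀ x) (σ x).2) p.2
        + lieSection N ω₀ x (fderiv ℝ σ x p.1) := by
  rw [lieVertical_eq N _ hx, fderiv_lieSection hω hx hσ, lieSection_apply N ω₀ x (σ x), map_sub,
    sub_apply]
  abel

variable [FiniteDimensional ℝ E]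

theorem fderiv_jet {η : E → E} {x : E} (hη : ContDiffAt ℝ ∞ η x) (v : E) :
    fderiv ℝ (jet q η) x v = (fderiv ℝ η x v, fderiv ℝ (posJet q η) x v) := by
  have h : HasFDerivAt (jet q η) _ x := (hη.differentiableAt (by simp)).hasFDerivAt.prodMk
    ((contDiffAt_posJet hη).differentiableAt (by simp)).hasFDerivAt
  rw [h.fderiv]
  rfl

/-- The operator `𝒟` turns the bracket of vector fields into the commutator of the Lie
derivatives. -/
theorem lieOp_lieBracket {N : NaturalBundle E F q} {ω₀ : E → F} {x : E}
    (hω : ContDiffAt ℝ ∞ ω₀ x) (hx : ω₀ x ∈ N.carrier) {ξ η : E → E}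
    (hξ : ∀ᶠ y in 𝓝 x, ContDiffAt ℝ ∞ ξ y) (hη : ∀ᶠ y in 𝓝 x, ContDiffAt ℝ ∞ η y) :
    lieOp N ω₀ (VectorField.lieBracket ℝ ξ η) x
      = lieVertical N ω₀ (lieOp N ω₀ η) x (jet q ξ x)
        - lieVertical N ω₀ (lieOp N ω₀ ξ) x (jet q η x) := by
  have hξx := hξ.self_of_nhds
  have hηx := hη.self_of_nhds
  have h1 := lieVertical_lieSection hω hx (σ := jet q η)
    ((contDiffAt_jet hηx).differentiableAt (by simp)) (jet q ξ x)
  have h2 := lieVertical_lieSection hω hx (σ := jet q ξ)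
    ((contDiffAt_jet hξx).differentiableAt (by simp)) (jet q η x)
  have hsymm : fderiv ℝ (fderiv ℝ ω₀) x (ξ x) (η x) = fderiv ℝ (fderiv ℝ ω₀) x (η x) (ξ x) :=
    hω.isSymmSndFDerivAt (by
      rw [minSmoothness_of_isRCLikeNormedField]
      exact WithTop.coe_le_coe.2 (le_top : (2 : ℕ∞) ≤ ⊤)) _ _
  rw [fderiv_jet hηx, lieSection_apply] at h1
  rw [fderiv_jet hξx, lieSection_apply] at h2
  change _ = lieVertical N ω₀ (fun y => lieSection N ω₀ y (jet q η y)) x (jet q ξ x)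
    - lieVertical N ω₀ (fun y => lieSection N ω₀ y (jet q ξ y)) x (jet q η x)
  rw [h1, h2, lieOp, lieSection_apply]
  simp only [jet]
  rw [gen_posJet_lieBracket N hx hξ hη, hsymm, VectorField.lieBracket, map_sub]
  abel

/-- The formal Lie derivative on `J_q(T)` and the Lie derivatives on `F₀` are compatible with
`Φ : J_q(T) → F₀`. -/
theorem lieSection_lieJet {N : NaturalBundle E F q} {ω₀ : E → F} {x : E}
    (hω : ContDiffAt ℝ ∞ ω₀ x) (hx : ω₀ x ∈ N.carrier) {ξ : E → E} {σ : E → JetT E q}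
    (hξ : ∀ᶠ y in 𝓝 x, ContDiffAt ℝ ∞ ξ y) (hσ : DifferentiableAt ℝ σ x) :
    lieSection N ω₀ x (lieJet ξ σ x)
      = lieVertical N ω₀ (fun y => lieSection N ω₀ y (σ y)) x (jet q ξ x)
        - lieVertical N ω₀ (lieOp N ω₀ ξ) x (σ x) := by
  set T : E → E := taylorRep x (σ x) with hT
  have hTs : ∀ y, ContDiffAt ℝ ∞ T y := fun y => (contDiff_taylorRep x (σ x)).contDiffAt
  have hTj : jet q T x = σ x := jet_taylorRep x (σ x)
  have hTd : DifferentiableAt ℝ (jet q T) x := (contDiffAt_jet (hTs x)).differentiableAt (by simp)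
  have h1 := lieOp_lieBracket hω hx hξ (.of_forall hTs)
  have h2 := lieVertical_lieSection hω hx hσ (jet q ξ x)
  have h3 := lieVertical_lieSection hω hx hTd (jet q ξ x)
  have h4 : fderiv ℝ (fun y => σ y - jet q T y) x (ξ x)
      = fderiv ℝ σ x (ξ x) - fderiv ℝ (jet q T) x (ξ x) := by
    rw [fderiv_fun_sub hσ hTd, sub_apply]
  have h5 : lieSection N ω₀ x (jet q (VectorField.lieBracket ℝ ξ T) x)
      = lieVertical N ω₀ (fun y => lieSection N ω₀ y (jet q T y)) x (jet q ξ x)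
        - lieVertical N ω₀ (lieOp N ω₀ ξ) x (jet q T x) := h1
  rw [lieJet, map_add, h4, map_sub, h5, h2, h3, hTj]
  simp only [jet]
  abel

variable {N : NaturalBundle E F q} {ω₀ : E → F} {Y : Set E}

/-- The defining system of the normalizer says that `𝒟 η` is an invariant section. -/
theorem mem_formalNormalizer_iff [FiniteDimensional ℝ F] (hY : IsOpen Y) (hω : ContDiffOn ℝ ∞ ω₀ Y)
    (hωN : ∀ x ∈ Y, ω₀ x ∈ N.carrier) (hs : ∀ x ∈ Y, Function.Surjective (gen N (ω₀ x)))
    {η : E → E} (hη : ContDiffOn ℝ ∞ η Y) :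
    η ∈ formalNormalizer N ω₀ Y ↔ lieOp N ω₀ η ∈ Upsilon0 N ω₀ Y := by
  have hωd {x : E} (hx : x ∈ Y) : ContDiffAt ℝ ∞ ω₀ x := hω.contDiffAt (hY.mem_nhds hx)
  have hηd {x : E} (hx : x ∈ Y) : ∀ᶠ y in 𝓝 x, ContDiffAt ℝ ∞ η y := by
    filter_upwards [hY.mem_nhds hx] with y hy using hη.contDiffAt (hY.mem_nhds hy)
  -- on sections of `R_q` the formal Lie derivative measures the invariance of `𝒟 η`
  have key {Z : Set E} (hZY : Z ⊆ Y) (hZ : IsOpen Z) {σ : E → JetT E q} (hσ : ContDiffOn ℝ ∞ σ Z)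
      (hσR : ∀ x ∈ Z, σ x ∈ Rq N ω₀ x) {x : E} (hx : x ∈ Z) :
      lieSection N ω₀ x (lieJet η σ x) = -lieVertical N ω₀ (lieOp N ω₀ η) x (σ x) := by
    have hzero : (fun y => lieSection N ω₀ y (σ y)) =ᶠ[𝓝 x] fun _ => 0 := by
      filter_upwards [hZ.mem_nhds hx] with y hy using hσR y hy
    have h0 : lieSection N ω₀ x (σ x) = 0 := hσR x hx
    rw [lieSection_lieJet (hωd (hZY hx)) (hωN x (hZY hx)) (hηd (hZY hx))
      ((hσ.contDiffAt (hZ.mem_nhds hx)).differentiableAt (by simp)),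
      lieVertical_eq N (fun y => lieSection N ω₀ y (σ y)) (hωN x (hZY hx)), hzero.fderiv_eq, h0]
    simp
  constructor
  · rintro ⟨-, hform⟩
    refine ⟨fun x hx => (contDiffAt_lieSection (hωd hx) (hωN x hx)
      (contDiffAt_jet (hηd hx).self_of_nhds)).contDiffWithinAt, fun x hx p hp => ?_⟩
    -- extend `p` to a local section of `R_q` with constant value of the vector field
    obtain ⟨ρ, hρ⟩ := exists_rightInverse_gen N (hωN x hx) (hs x hx)
    obtain ⟨Z, hZ, hZo, hxZ⟩ := eventually_nhds_iff.1
      (((hωd hx).continuousAt.eventually hρ).and (hY.mem_nhds hx))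
    let σ : E → JetT E q := fun y =>
      (p.1, p.2 + ρ (ω₀ y) (fderiv ℝ ω₀ y p.1 - gen N (ω₀ y) p.2))
    have hσ : ContDiffOn ℝ ∞ σ Z := fun y hy => by
      obtain ⟨⟨hρy, -⟩, hyY⟩ := hZ y hy
      have hω' := hωd hyY
      refine ContDiffAt.contDiffWithinAt (contDiffAt_const.prodMk (contDiffAt_const.add
        ((hρy.comp y hω').clm_apply (ContDiffAt.sub ?_ ?_))))
      · exact (hω'.fderiv_right (m := ∞) (by simp)).clm_apply contDiffAt_const
      · exact ((contDiffAt_gen N (hωN y hyY)).comp y hω').clm_apply contDiffAt_const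
    have hσR (y) (hy : y ∈ Z) : σ y ∈ Rq N ω₀ y := by
      rw [mem_Rq]
      simp only [σ, map_add, (hZ y hy).1.2]
      abel
    have hσx : σ x = p := by
      have h : fderiv ℝ ω₀ x p.1 - gen N (ω₀ x) p.2 = 0 := hp
      simp only [σ, h, map_zero, add_zero]
    have hZY : Z ⊆ Y := fun y hy => (hZ y hy).2
    have h := key hZY hZo hσ hσR hxZ
    rw [show lieSection N ω₀ x (lieJet η σ x) = 0 from hform Z hZY hZo σ hσ hσR x hxZ, hσx] at h
    exact neg_eq_zero.1 h.symm
  · rintro ⟨-, hinv⟩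
    refine ⟨hη, fun Z hZY hZ σ hσ hσR x hx => ?_⟩
    change lieSection N ω₀ x (lieJet η σ x) = 0
    rw [key hZY hZ hσ hσR hx, hinv x (hZY hx) _ (hσR x hx), neg_zero]

theorem lieOp_lieBracket_of_mem_Theta (hω : ContDiffOn ℝ ∞ ω₀ Y)
    (hωN : ∀ x ∈ Y, ω₀ x ∈ N.carrier) {η : E → E} (hη : ContDiffOn ℝ ∞ η Y) {Z : Set E}
    (hZY : Z ⊆ Y) (hZ : IsOpen Z) {ξ : E → E} (hξ : ξ ∈ Theta N ω₀ Z) {x : E} (hx : x ∈ Z) :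
    lieOp N ω₀ (VectorField.lieBracket ℝ ξ η) x
      = lieVertical N ω₀ (lieOp N ω₀ η) x (jet q ξ x) := by
  have hzero : lieOp N ω₀ ξ =ᶠ[𝓝 x] fun _ => 0 := by
    filter_upwards [hZ.mem_nhds hx] with y hy using hξ.2 y hy
  rw [lieOp_lieBracket ((hω.mono hZY).contDiffAt (hZ.mem_nhds hx)) (hωN x (hZY hx)),
    lieVertical_eq N (lieOp N ω₀ ξ) (hωN x (hZY hx)), hzero.fderiv_eq, hξ.2 x hx]
  · simp
  · filter_upwards [hZ.mem_nhds hx] with y hy using hξ.1.contDiffAt (hZ.mem_nhds hy)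
  · filter_upwards [hZ.mem_nhds hx] with y hy using (hη.mono hZY).contDiffAt (hZ.mem_nhds hy)

theorem mem_normalizer_of_mem_Upsilon0 (hω : ContDiffOn ℝ ∞ ω₀ Y)
    (hωN : ∀ x ∈ Y, ω₀ x ∈ N.carrier) {η : E → E} (hη : ContDiffOn ℝ ∞ η Y)
    (h : lieOp N ω₀ η ∈ Upsilon0 N ω₀ Y) : η ∈ normalizer N ω₀ Y := by
  refine ⟨hη, fun Z hZY hZ ξ hξ => ⟨fun x hx => ?_, fun x hx => ?_⟩⟩
  · exact ((hξ.1.contDiffAt (hZ.mem_nhds hx)).lieBracket_vectorField (m := ∞)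
      ((hη.mono hZY).contDiffAt (hZ.mem_nhds hx)) (by simp)).contDiffWithinAt
  · rw [lieOp_lieBracket_of_mem_Theta hω hωN hη hZY hZ hξ hx]
    exact h.2 x (hZY hx) _ (hξ.2 x hx)

theorem mem_Upsilon0_of_mem_normalizer (hY : IsOpen Y) (hω : ContDiffOn ℝ ∞ ω₀ Y)
    (hωN : ∀ x ∈ Y, ω₀ x ∈ N.carrier) (hsys : IsSystemOfTheta N ω₀ Y) {η : E → E}
    (h : η ∈ normalizer N ω₀ Y) : lieOp N ω₀ η ∈ Upsilon0 N ω₀ Y := by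
  refine ⟨fun x hx => ?_, fun x hx p hp => ?_⟩
  · exact (contDiffAt_lieSection (hω.contDiffAt (hY.mem_nhds hx)) (hωN x hx)
      (contDiffAt_jet (h.1.contDiffAt (hY.mem_nhds hx)))).contDiffWithinAt
  · obtain ⟨Z, hZY, hZ, hxZ, ξ, hξ, rfl⟩ := hsys x hx p hp
    rw [← lieOp_lieBracket_of_mem_Theta hω hωN h.1 hZY hZ hξ hxZ]
    exact (h.2 Z hZY hZ ξ hξ).2 x hxZ

end Invariants

end LieEq

open LieEq in
theorem proposition5p26
    {E F : Type*} [NormedAddCommGroup E] [NormedSpace ℝ E] [FiniteDimensional ℝ E]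
    [NormedAddCommGroup F] [NormedSpace ℝ F] [FiniteDimensional ℝ F]
    (q : ℕ) (N : NaturalBundle E F q)
    (X : Set E) (hX : IsOpen X)
    (ω₀ : E → F) (hω₀ : ContDiffOn ℝ ∞ ω₀ X) (hω₀N : MapsTo ω₀ X N.carrier)
    -- `R_q` is transitive: `R_q → T` is onto
    (htrans : ∀ x ∈ X, ∀ ξ : E, ∃ a : PosJet E q, (ξ, a) ∈ Rq N ω₀ x)
    -- `F_0 = J_q(T) / R_q`: `Φ : J_q(T) → F_0` is onto
    (hepi : ∀ x ∈ X, Function.Surjective (lieSection N ω₀ x))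
    (x₀ : E) (hx₀ : x₀ ∈ X) :
    ∃ V₀ ∈ 𝓝 (ω₀ x₀), V₀ ⊆ N.carrier ∧
      ∀ V ⊆ V₀, IsOpen V → IsConnected V →
      ∀ Y ⊆ X, IsOpen Y → IsConnected Y → x₀ ∈ Y → MapsTo ω₀ Y V →
        (∃ p ≤ Module.finrank ℝ F, ∃ W : Fin p → F → F, IsLabelBasis N V W) ∧
        ∀ (p : ℕ) (W : Fin p → F → F), IsLabelBasis N V W →
          -- the invariant sections of `F_0`
          (∀ Ω : E → F, Ω ∈ Upsilon0 N ω₀ Y ↔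
            ∃! A : Fin p → ℝ, ∀ x ∈ Y, Ω x = ∑ α, A α • W α (ω₀ x)) ∧
          -- the normalizer
          (∀ η : E → E, ContDiffOn ℝ ∞ η Y →
            (η ∈ formalNormalizer N ω₀ Y ↔
              ∃ A : Fin p → ℝ, ∀ x ∈ Y, lieOp N ω₀ η x = ∑ α, A α • W α (ω₀ x)) ∧
            ((∃ A : Fin p → ℝ, ∀ x ∈ Y, lieOp N ω₀ η x = ∑ α, A α • W α (ω₀ x)) →
              η ∈ normalizer N ω₀ Y) ∧
            (IsSystemOfTheta N ω₀ Y → η ∈ normalizer N ω₀ Y →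
              ∃ A : Fin p → ℝ, ∀ x ∈ Y, lieOp N ω₀ η x = ∑ α, A α • W α (ω₀ x))) := by
  obtain ⟨V₀, hV₀, hV₀N, hV₀s, hV₀W⟩ := exists_label_nhds N (hω₀N hx₀)
    (surjective_gen (htrans x₀ hx₀) (hepi x₀ hx₀))
  refine ⟨V₀, hV₀, hV₀N, fun V hVV₀ hV hVc Y hYX hY hYc hx₀Y hωV => ?_⟩
  have hVN : V ⊆ N.carrier := hVV₀.trans hV₀N
  have hVs (v) (hv : v ∈ V) : Function.Surjective (gen N v) := hV₀s v (hVV₀ hv)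
  have hex (w : F) (hw : ∀ a, gen N (ω₀ x₀) a = 0 → fderiv ℝ (gen N) (ω₀ x₀) w a = 0) :
      ∃ W, W (ω₀ x₀) = w ∧ IsInfinitesimalLabel N V W := by
    obtain ⟨W, hWw, hW⟩ := hV₀W w hw
    exact ⟨W, hWw, hW.mono hVV₀⟩
  have hω := hω₀.mono hYX
  have hωN (x) (hx : x ∈ Y) : ω₀ x ∈ N.carrier := hVN (hωV hx)
  refine ⟨exists_isLabelBasis hV hVc.isPreconnected hVN hVs (hωV hx₀Y) hex, fun p W hW => ?_⟩
  have hiff := mem_Upsilon0_iff hV hVN hVs hY hYc.isPreconnected hω hωV hx₀Y hex hW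
  refine ⟨fun Ω => ⟨fun hΩ => ?_, fun hA => (hiff Ω).2 hA.exists⟩, fun η hη => ⟨?_, ?_, ?_⟩⟩
  · obtain ⟨A, hA⟩ := (hiff Ω).1 hΩ
    refine ⟨A, hA, fun B hB => sub_eq_zero.1 (hW.independent (B - A) ?_)⟩
    refine (IsInfinitesimalLabel.sum_smul hV hVN hW.label (B - A)).eq_zero hV hVc.isPreconnected
      hVN hVs (hωV hx₀Y) ?_
    simp only [Pi.sub_apply, sub_smul, Finset.sum_sub_distrib]
    rw [← hA x₀ hx₀Y, ← hB x₀ hx₀Y, sub_self]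
  · rw [mem_formalNormalizer_iff hY hω hωN (fun x hx => hVs _ (hωV hx)) hη, hiff]
  · exact fun h => mem_normalizer_of_mem_Upsilon0 hω hωN hη ((hiff _).2 h)
  · exact fun hsys h => (hiff _).1 (mem_Upsilon0_of_mem_normalizer hY hω hωN hsys h)
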